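/- Let $n\ge 1$ be an integer and $s\in(0,1)$. Write $\mathbb{R}^n_+=\{x\in\mathbb{R}^n : x_1>0\}$, let $B_1$ be the open unit ball of $\mathbb{R}^n$ centred at the origin, $B_1^+=B_1\cap\mathbb{R}^n_+$, and let $e_1$ be the first unit vector. Let $H^s(\mathbb{R}^n)$ be the space of all $u\in L^2(\mathbb{R}^n)$ with $$\iint_{\mathbb{R}^n\times\mathbb{R}^n}\frac{|u(x)-u(y)|^2}{|x-y|^{n+2s}}\,dx\,dy<\infty ,$$ and let $\mathcal{H}^s_0(B_1^+)$ be the set of $v\in H^s(\mathbb{R}^n)$ with $v=0$ almost everywhere in $\mathbb{R}^n\setminus B_1^+$. A function $u:\mathbb{R}^n\to\mathbb{R}$ is called $x_1$-antisymmetric if $u(x-2x_1e_1)=-u(x)$ for all $x\in\mathbb{R}^n$. For $c\in L^\infty(B_1^+)$ and $u\in H^s(\mathbb{R}^n)$, the inequality $(-\Delta)^su+cu\ge 0$ is said to hold weakly in $B_1^+$ if $$\frac{c_{n,s}}{2}\iint_{\mathbb{R}^n\times\mathbb{R}^n}\frac{(u(x)-u(y))(v(x)-v(y))}{|x-y|^{n+2s}}\,dx\,dy+\int_{B_1^+}c(x)u(x)v(x)\,dx\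 \ge\ 0$$ for all $v\in\mathcal{H}^s_0(B_1^+)$ with $v\ge0$ almost everywhere, where $c_{n,s}=\dfrac{s\,4^s\,\Gamma\left(\frac{n+2s}{2}\right)}{\pi^{n/2}\,\Gamma(1-s)}$ is the normalisation constant of the fractional Laplacian. **Theorem.** Let $c\in L^\infty(B_1^+)$ and let $u\in H^s(\mathbb{R}^n)\cap C(B_1)$ be $x_1$-antisymmetric. Suppose that $(-\Delta)^su+cu\ge0$ weakly in $B_1^+$, that $u\ge0$ almost everywhere in $\mathbb{R}^n_+$, and that $u>0$ everywhere in $B_1^+$. Then $$\liminf_{h\to0}\frac{u(he_1)}{h}>0,$$ where $h\to 0$ through nonzero real numbers and the lower limit is taken in $[-\infty,+\infty]$. -/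

import Mathlib

open MeasureTheory Filter Topology
open scoped ENNReal

noncomputable section

namespace FracHopf

/-- The open half-space `ℝⁿ₊ = {x : x₁ > 0}`; the first coordinate has index `0`. -/
def halfSpace (n : ℕ) [NeZero n] : Set (EuclideanSpace ℝ (Fin n)) :=
  {x | 0 < x 0}

/-- The open unit half-ball `B₁⁺ = B₁ ∩ ℝⁿ₊`. -/
def halfBall (n : ℕ) [NeZero n] : Set (EuclideanSpace ℝ (Fin n)) :=
  Metric.ball 0 1 ∩ halfSpace n

/-- The first unit vector `e₁`. -/
def e₁ (n : ℕ) [NeZero n] : EuclideanSpace ℝ (Fin n) :=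
  EuclideanSpace.single 0 1

/-- `u` is `x₁`-antisymmetric: `u(x - 2 x₁ e₁) = -u(x)` for all `x`. -/
def IsAntisymmetric {n : ℕ} [NeZero n] (u : EuclideanSpace ℝ (Fin n) → ℝ) : Prop :=
  ∀ x, u (x - (2 * x 0) • e₁ n) = - u x

/-- Membership in `H^s(ℝⁿ)`: `u ∈ L²` with finite Gagliardo seminorm.  The integrand has the
value `0` on the diagonal, which is a null set of `ℝⁿ × ℝⁿ`. -/
def MemHs {n : ℕ} (s : ℝ) (u : EuclideanSpace ℝ (Fin n) → ℝ) : Prop :=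
  MemLp u 2 volume ∧
    ∫⁻ p : EuclideanSpace ℝ (Fin n) × EuclideanSpace ℝ (Fin n),
      ENNReal.ofReal (|u p.1 - u p.2| ^ 2 / ‖p.1 - p.2‖ ^ ((n : ℝ) + 2 * s)) < ∞

/-- Membership in `𝓗₀^s(Ω)`: functions of `H^s(ℝⁿ)` vanishing (a.e.) outside `Ω`. -/
def MemHsZero {n : ℕ} (s : ℝ) (Ω : Set (EuclideanSpace ℝ (Fin n)))
    (v : EuclideanSpace ℝ (Fin n) → ℝ) : Prop :=
  MemHs s v ∧ ∀ᵐ x, x ∉ Ω → v x = 0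

/-- The normalisation constant `c_{n,s} = s 4^s Γ((n+2s)/2) / (π^{n/2} Γ(1-s))` of the
fractional Laplacian. -/
def fracConst (n : ℕ) (s : ℝ) : ℝ :=
  s * 4 ^ s * Real.Gamma (((n : ℝ) + 2 * s) / 2) /
    (Real.pi ^ ((n : ℝ) / 2) * Real.Gamma (1 - s))

/-- The bilinear form
`𝓔(u,v) = (c_{n,s}/2) ∬ (u(x)-u(y)) (v(x)-v(y)) / |x-y|^{n+2s} dx dy`. -/
def energy {n : ℕ} (s : ℝ) (u v : EuclideanSpace ℝ (Fin n) → ℝ) : ℝ :=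
  fracConst n s / 2 *
    ∫ p : EuclideanSpace ℝ (Fin n) × EuclideanSpace ℝ (Fin n),
      (u p.1 - u p.2) * (v p.1 - v p.2) / ‖p.1 - p.2‖ ^ ((n : ℝ) + 2 * s)

/-- `(-Δ)^s u + c u ≥ 0` weakly in `Ω` (for `u ∈ H^s(ℝⁿ)`, `c ∈ L^∞(Ω)`; both integrals then
converge absolutely). -/
def IsWeakSupersolution {n : ℕ} (s : ℝ) (Ω : Set (EuclideanSpace ℝ (Fin n)))
    (c u : EuclideanSpace ℝ (Fin n) → ℝ) : Prop :=
  ∀ v : EuclideanSpace ℝ (Fin n) → ℝ, MemHsZero s Ω v → (∀ᵐ x, 0 ≤ v x) →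
    0 ≤ energy s u v + ∫ x in Ω, c x * u x * v x

end FracHopf

end

noncomputable section

namespace FracHopf

section

variable {n : ℕ}

/-! ### The reflection across the hyperplane `x₁ = 0` -/

section Reflection

variable [NeZero n]

/-! The proof compares `u` with an explicit antisymmetric subsolution that grows linearly at the
origin. Take Φ = φ + M g, where φ = x₁(1/64 - |x|²)₊ and g is the odd reflection of a bump centred
at e₁/2, away from the small half-ball.

For test functions v ≥ 0 supported in the small half-ball, the form of φ against v is at most a
constant times ∫ x₁ v (`integral_energyDensity_coordBump_le`). The form of g against v is at most a
negative constant times the same integral (`integral_energyDensity_oddFarBump_le`): mass at distance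
contributes with a negative sign, and its mirror image of opposite sign cancels all of it except a
part of order x₁. A large M therefore makes Φ a strict subsolution, even with the zeroth-order term
included (`exists_barrier`).

Let w = u - εΦ, with ε small enough that w ≥ 0 in the half-space outside the small half-ball; the
positive minimum of `u` on the support of the far bump permits this. The negative part v of w, cut
off to the half-space, is an admissible test function (`memHs_halfNegPart`). The form of w against v
is nonpositive, because antisymmetry lets the integrand be summed over reflections of both
variables, and that sum has a sign (`energy_halfNegPart_nonpos`). Combined with the supersolution
inequality for `u`, this gives ∫ x₁ v ≤ 0, so v = 0 a.e. By continuity u ≥ εφ near the origin, and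
φ(he₁)/h tends to 1/64. -/

@[simp] theorem e₁_zero : e₁ n 0 = 1 := by simp [e₁]

theorem norm_e₁ : ‖e₁ n‖ = 1 := by simp [e₁]

theorem inner_e₁ (x : EuclideanSpace ℝ (Fin n)) : inner ℝ x (e₁ n) = x 0 := by
  simp [e₁, EuclideanSpace.inner_single_right]

theorem abs_coord_le_norm (x : EuclideanSpace ℝ (Fin n)) : |x 0| ≤ ‖x‖ := by
  simpa using PiLp.norm_apply_le x 0

/-- The map `x ↦ x - 2 x₁ e₁` as a linear map. -/
def reflectLin (n : ℕ) [NeZero n] : EuclideanSpace ℝ (Fin n) →ₗ[ℝ] EuclideanSpace ℝ (Fin n) where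
  toFun x := x - (2 * x 0) • e₁ n
  map_add' x y := by simp only [PiLp.add_apply]; module
  map_smul' c x := by simp only [PiLp.smul_apply, smul_eq_mul, RingHom.id_apply]; module

theorem reflectLin_apply (x : EuclideanSpace ℝ (Fin n)) :
    reflectLin n x = x - (2 * x 0) • e₁ n := rfl

theorem reflectLin_involutive : Function.Involutive (reflectLin n) := by
  intro x
  simp only [reflectLin_apply, PiLp.sub_apply, PiLp.smul_apply, e₁_zero, smul_eq_mul]
  module

/-- Every kernel comparison rests on this identity: reflecting one of two points on the same side of
the hyperplane increases their distance, by an amount governed by x₁y₁. -/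
theorem norm_sub_reflectLin_sq (x y : EuclideanSpace ℝ (Fin n)) :
    ‖x - reflectLin n y‖ ^ 2 = ‖x - y‖ ^ 2 + 4 * x 0 * y 0 := by
  have h : x - reflectLin n y = (x - y) + (2 * y 0) • e₁ n := by
    rw [reflectLin_apply]; module
  rw [h, norm_add_sq_real, inner_smul_right, inner_e₁, norm_smul, norm_e₁, mul_one,
    Real.norm_eq_abs, sq_abs, PiLp.sub_apply]
  ring

/-- The reflection across the hyperplane `x₁ = 0`. -/
def reflect (n : ℕ) [NeZero n] : EuclideanSpace ℝ (Fin n) ≃ₗᵢ[ℝ] EuclideanSpace ℝ (Fin n) where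
  toLinearEquiv := LinearEquiv.ofInvolutive (reflectLin n) reflectLin_involutive
  norm_map' x := by
    have h := norm_sub_reflectLin_sq (0 : EuclideanSpace ℝ (Fin n)) x
    simp only [zero_sub, norm_neg, PiLp.zero_apply, mul_zero, zero_mul, add_zero] at h
    exact (pow_left_inj₀ (norm_nonneg _) (norm_nonneg _) two_ne_zero).1 h

theorem reflect_apply (x : EuclideanSpace ℝ (Fin n)) :
    reflect n x = x - (2 * x 0) • e₁ n := rfl

@[simp] theorem reflect_reflect (x : EuclideanSpace ℝ (Fin n)) : reflect n (reflect n x) = x :=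
  reflectLin_involutive x

@[simp] theorem reflect_coord (x : EuclideanSpace ℝ (Fin n)) : reflect n x 0 = - x 0 := by
  rw [reflect_apply, PiLp.sub_apply, PiLp.smul_apply, e₁_zero, smul_eq_mul]; ring

theorem norm_sub_reflect_sq (x y : EuclideanSpace ℝ (Fin n)) :
    ‖x - reflect n y‖ ^ 2 = ‖x - y‖ ^ 2 + 4 * x 0 * y 0 :=
  norm_sub_reflectLin_sq x y

theorem norm_reflect_sub (x y : EuclideanSpace ℝ (Fin n)) :
    ‖reflect n x - y‖ = ‖x - reflect n y‖ := by
  rw [← (reflect n).norm_map (reflect n x - y), map_sub, reflect_reflect]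

theorem IsAntisymmetric.reflect {u : EuclideanSpace ℝ (Fin n) → ℝ} (h : IsAntisymmetric u)
    (x : EuclideanSpace ℝ (Fin n)) : u (reflect n x) = - u x := h x

theorem measurePreserving_reflect :
    MeasurePreserving (reflect n) (volume : Measure (EuclideanSpace ℝ (Fin n))) volume :=
  (reflect n).measurePreserving

theorem integral_comp_reflect (f : EuclideanSpace ℝ (Fin n) → ℝ) :
    ∫ x, f (reflect n x) = ∫ x, f x :=
  measurePreserving_reflect.integral_comp (reflect n).toHomeomorph.measurableEmbedding f

theorem measurePreserving_reflect_fst :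
    MeasurePreserving (Prod.map (reflect n) id)
      (volume : Measure (EuclideanSpace ℝ (Fin n) × EuclideanSpace ℝ (Fin n))) volume :=
  measurePreserving_reflect.prod (MeasurePreserving.id _)

theorem measurePreserving_reflect_snd :
    MeasurePreserving (Prod.map id (reflect n))
      (volume : Measure (EuclideanSpace ℝ (Fin n) × EuclideanSpace ℝ (Fin n))) volume :=
  (MeasurePreserving.id _).prod measurePreserving_reflect

theorem measurableEmbedding_reflect_fst :
    MeasurableEmbedding (Prod.map (reflect n) (id : EuclideanSpace ℝ (Fin n) → _)) :=
  ((reflect n).toHomeomorph.prodCongr (Homeomorph.refl _)).measurableEmbedding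

theorem measurableEmbedding_reflect_snd :
    MeasurableEmbedding (Prod.map (id : EuclideanSpace ℝ (Fin n) → _) (reflect n)) :=
  ((Homeomorph.refl _).prodCongr (reflect n).toHomeomorph).measurableEmbedding

/-- The diagonal has to be discarded because the kernel takes the value 0 there, which breaks its
monotonicity in the distance. -/
theorem ae_fst_ne_snd :
    ∀ᵐ p : EuclideanSpace ℝ (Fin n) × EuclideanSpace ℝ (Fin n), p.1 ≠ p.2 := by
  have hm : MeasurableSet
      {p : EuclideanSpace ℝ (Fin n) × EuclideanSpace ℝ (Fin n) | p.1 = p.2} :=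
    (isClosed_eq continuous_fst continuous_snd).measurableSet
  rw [ae_iff]
  simp only [ne_eq, not_not]
  rw [Measure.volume_eq_prod, Measure.measure_prod_null hm]
  refine Eventually.of_forall fun x => ?_
  have : Prod.mk x ⁻¹' {p : EuclideanSpace ℝ (Fin n) × EuclideanSpace ℝ (Fin n) | p.1 = p.2}
      = {x} := by
    ext y; simp [eq_comm]
  change volume (_ : Set (EuclideanSpace ℝ (Fin n))) = 0
  rw [this]
  simp

end Reflection

/-! ### The kernel -/

/-- The kernel `|x - y|^{-(n+2s)}`, with the value `0` on the diagonal. -/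
def kern (s : ℝ) (x y : EuclideanSpace ℝ (Fin n)) : ℝ := (‖x - y‖ ^ ((n : ℝ) + 2 * s))⁻¹

theorem kern_nonneg (s : ℝ) (x y : EuclideanSpace ℝ (Fin n)) : 0 ≤ kern s x y := by
  unfold kern; positivity

theorem kern_symm (s : ℝ) (x y : EuclideanSpace ℝ (Fin n)) : kern s x y = kern s y x := by
  rw [kern, kern, norm_sub_rev]

theorem measurable_kern (s : ℝ) :
    Measurable fun p : EuclideanSpace ℝ (Fin n) × EuclideanSpace ℝ (Fin n) => kern s p.1 p.2 := by
  unfold kern; fun_prop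

theorem kern_le_kern {s : ℝ} (hs : 0 < s) {x y x' y' : EuclideanSpace ℝ (Fin n)}
    (h : x ≠ y) (hle : ‖x - y‖ ≤ ‖x' - y'‖) : kern s x' y' ≤ kern s x y := by
  have h0 : 0 < ‖x - y‖ := norm_pos_iff.2 (sub_ne_zero.2 h)
  unfold kern
  gcongr

section

variable [NeZero n]

theorem kern_reflect_left (s : ℝ) (x y : EuclideanSpace ℝ (Fin n)) :
    kern s (reflect n x) y = kern s x (reflect n y) := by
  rw [kern, kern, norm_reflect_sub]

theorem kern_reflect_le {s : ℝ} (hs : 0 < s) {x y : EuclideanSpace ℝ (Fin n)} (hne : x ≠ y)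
    (h : 0 ≤ x 0 * y 0) : kern s x (reflect n y) ≤ kern s x y := by
  refine kern_le_kern hs hne ?_
  refine (sq_le_sq₀ (norm_nonneg _) (norm_nonneg _)).1 ?_
  rw [norm_sub_reflect_sq]; linarith

theorem kern_le_reflect {s : ℝ} (hs : 0 < s) {x y : EuclideanSpace ℝ (Fin n)}
    (hne : x ≠ reflect n y) (h : x 0 * y 0 ≤ 0) : kern s x y ≤ kern s x (reflect n y) := by
  have := kern_reflect_le hs hne (by rw [reflect_coord]; linarith)
  rwa [reflect_reflect] at this

/-- A quantitative version of `kern_reflect_le`. -/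
theorem le_kern_sub_reflect {s : ℝ} (hs : 0 < s) {x y : EuclideanSpace ℝ (Fin n)} (hne : x ≠ y)
    (hxy : ‖x - y‖ ≤ 1) (hx : 0 ≤ x 0) (hx1 : x 0 ≤ 1) (hy : 1 / 4 ≤ y 0) (hy1 : y 0 ≤ 1) :
    s * (5 ^ (((n : ℝ) + 2 * s) / 2))⁻¹ / 5 * x 0 ≤ kern s x y - kern s x (reflect n y) := by
  set P : ℝ := ((n : ℝ) + 2 * s) / 2 with hP
  have hPs : s ≤ P := by rw [hP]; have : (0 : ℝ) ≤ n := Nat.cast_nonneg n; linarith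
  have h0 : 0 < ‖x - y‖ := norm_pos_iff.2 (sub_ne_zero.2 hne)
  set t := ‖x - y‖ ^ 2 with ht
  have ht0 : 0 < t := by positivity
  have ht1 : t ≤ 1 := by rw [ht]; nlinarith
  set b := ‖x - reflect n y‖ ^ 2 with hb
  have hbt : b = t + 4 * x 0 * y 0 := norm_sub_reflect_sq x y
  have hbt' : t + x 0 ≤ b := by rw [hbt]; nlinarith
  have hb0 : 0 < b := by linarith
  have hb5 : b ≤ 5 := by rw [hbt]; nlinarith
  have hk : ∀ r : ℝ, 0 ≤ r → (r ^ ((n : ℝ) + 2 * s)) = (r ^ 2) ^ P := by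
    intro r hr
    rw [← Real.rpow_natCast r 2, ← Real.rpow_mul hr]
    congr 1; rw [hP]; push_cast; ring
  unfold kern
  rw [hk _ (norm_nonneg _), hk _ (norm_nonneg _), ← ht, ← hb]
  -- With r = b/t, r^P = exp(P log r) ≥ 1 + P log r ≥ 1 + P(1 - 1/r). This bounds the kernel
  -- difference below even when t is small.
  have hratio : 1 + P * (1 - t / b) ≤ (b / t) ^ P := by
    have hbt0 : 0 < b / t := by positivity
    have h1 : 1 - (b / t)⁻¹ ≤ Real.log (b / t) := Real.one_sub_inv_le_log_of_pos hbt0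
    have h2 := Real.add_one_le_exp (Real.log (b / t) * P)
    rw [Real.rpow_def_of_pos hbt0]
    rw [inv_div] at h1
    nlinarith
  rw [Real.div_rpow hb0.le ht0.le] at hratio
  have hbP : 0 < b ^ P := by positivity
  have htP : 0 < t ^ P := by positivity
  have e1 : (t ^ P)⁻¹ = b ^ P / t ^ P * (b ^ P)⁻¹ := by field_simp
  have h3 : (5 ^ P)⁻¹ ≤ (b ^ P)⁻¹ := by
    gcongr
  have h4 : x 0 / 5 ≤ 1 - t / b := by
    rw [one_sub_div hb0.ne', div_le_div_iff₀ (by norm_num) hb0]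
    nlinarith
  have h5 : 0 < ((5 : ℝ) ^ P)⁻¹ := by positivity
  calc s * (5 ^ P)⁻¹ / 5 * x 0 = (s * (x 0 / 5)) * (5 ^ P)⁻¹ := by ring
    _ ≤ (P * (1 - t / b)) * (b ^ P)⁻¹ := by
        apply mul_le_mul _ h3 h5.le
        · exact mul_nonneg (by linarith) (by linarith [show 0 ≤ x 0 / 5 by positivity])
        · exact mul_le_mul hPs h4 (by positivity) (by linarith)
    _ ≤ (b ^ P / t ^ P - 1) * (b ^ P)⁻¹ := by
        gcongr
        linarith
    _ = (t ^ P)⁻¹ - (b ^ P)⁻¹ := by rw [sub_mul, ← e1, one_mul]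

end

end

section

variable {n : ℕ}

/-! ### The space `H^s` -/

theorem aestronglyMeasurable_sub_fst_snd {u : EuclideanSpace ℝ (Fin n) → ℝ}
    (hu : AEStronglyMeasurable u) :
    AEStronglyMeasurable
      (fun p : EuclideanSpace ℝ (Fin n) × EuclideanSpace ℝ (Fin n) => u p.1 - u p.2) :=
  hu.comp_fst.sub hu.comp_snd

theorem memHs_iff {s : ℝ} {u : EuclideanSpace ℝ (Fin n) → ℝ} :
    MemHs s u ↔ MemLp u 2 volume ∧
      Integrable (fun p : EuclideanSpace ℝ (Fin n) × EuclideanSpace ℝ (Fin n) =>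
        (u p.1 - u p.2) ^ 2 * kern s p.1 p.2) := by
  unfold MemHs
  refine and_congr_right fun hu => ?_
  have hm : AEStronglyMeasurable
      (fun p : EuclideanSpace ℝ (Fin n) × EuclideanSpace ℝ (Fin n) =>
        (u p.1 - u p.2) ^ 2 * kern s p.1 p.2) :=
    ((aestronglyMeasurable_sub_fst_snd hu.1).pow 2).mul (measurable_kern s).aestronglyMeasurable
  rw [Integrable, and_iff_right hm, hasFiniteIntegral_iff_ofReal
    (Eventually.of_forall fun p => mul_nonneg (sq_nonneg _) (kern_nonneg _ _ _))]
  simp only [sq_abs, div_eq_mul_inv, kern]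

theorem MemHs.add {s : ℝ} {u v : EuclideanSpace ℝ (Fin n) → ℝ} (hu : MemHs s u)
    (hv : MemHs s v) : MemHs s (fun x => u x + v x) := by
  rw [memHs_iff] at *
  refine ⟨hu.1.add hv.1, ((hu.2.add hv.2).const_mul 2).mono' ?_ ?_⟩
  · exact ((aestronglyMeasurable_sub_fst_snd (hu.1.add hv.1).1).pow 2).mul
      (measurable_kern s).aestronglyMeasurable
  · refine Eventually.of_forall fun p => ?_
    have hk := kern_nonneg s p.1 p.2
    rw [Real.norm_of_nonneg (mul_nonneg (sq_nonneg _) hk)]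
    simp only [Pi.add_apply]
    nlinarith [mul_nonneg hk (sq_nonneg ((u p.1 - u p.2) - (v p.1 - v p.2)))]

theorem MemHs.const_mul {s : ℝ} {u : EuclideanSpace ℝ (Fin n) → ℝ} (hu : MemHs s u) (a : ℝ) :
    MemHs s (fun x => a * u x) := by
  rw [memHs_iff] at *
  refine ⟨hu.1.const_mul a, (hu.2.const_mul (a ^ 2)).congr (Eventually.of_forall fun p => ?_)⟩
  simp only
  ring

/-- The integrand of the bilinear form. -/
def energyDensity (s : ℝ) (u v : EuclideanSpace ℝ (Fin n) → ℝ)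
    (p : EuclideanSpace ℝ (Fin n) × EuclideanSpace ℝ (Fin n)) : ℝ :=
  (u p.1 - u p.2) * (v p.1 - v p.2) * kern s p.1 p.2

theorem energy_eq (s : ℝ) (u v : EuclideanSpace ℝ (Fin n) → ℝ) :
    energy s u v = fracConst n s / 2 * ∫ p, energyDensity s u v p := by
  simp only [energy, energyDensity, kern, div_eq_mul_inv]

theorem MemHs.integrable_energyDensity {s : ℝ} {u v : EuclideanSpace ℝ (Fin n) → ℝ}
    (hu : MemHs s u) (hv : MemHs s v) : Integrable (energyDensity s u v) := by
  rw [memHs_iff] at *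
  refine (hu.2.add hv.2).mono' ?_ (Eventually.of_forall fun p => ?_)
  · exact ((aestronglyMeasurable_sub_fst_snd hu.1.1).mul
      (aestronglyMeasurable_sub_fst_snd hv.1.1)).mul (measurable_kern s).aestronglyMeasurable
  · have hk := kern_nonneg s p.1 p.2
    rw [energyDensity, norm_mul, Real.norm_of_nonneg hk, Pi.add_apply, ← add_mul]
    refine mul_le_mul_of_nonneg_right ?_ hk
    rw [Real.norm_eq_abs, abs_le]
    constructor <;>
    nlinarith [sq_nonneg ((u p.1 - u p.2) - (v p.1 - v p.2)),
      sq_nonneg ((u p.1 - u p.2) + (v p.1 - v p.2))]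

theorem energy_add_const_mul {s : ℝ} {u φ v : EuclideanSpace ℝ (Fin n) → ℝ}
    (hu : MemHs s u) (hφ : MemHs s φ) (hv : MemHs s v) (a : ℝ) :
    energy s (fun x => u x + a * φ x) v = energy s u v + a * energy s φ v := by
  have h : energyDensity s (fun x => u x + a * φ x) v
      = fun p => energyDensity s u v p + a * energyDensity s φ v p := by
    funext p; simp only [energyDensity]; ring
  rw [energy_eq, energy_eq, energy_eq, h,
    integral_add (hu.integrable_energyDensity hv) ((hφ.integrable_energyDensity hv).const_mul a),
    integral_const_mul]
  ring

theorem fracConst_pos {s : ℝ} (hs0 : 0 < s) (hs1 : s < 1) : 0 < fracConst n s := by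
  unfold fracConst
  have h1 : 0 < Real.Gamma (((n : ℝ) + 2 * s) / 2) := Real.Gamma_pos_of_pos (by positivity)
  have h2 : 0 < Real.Gamma (1 - s) := Real.Gamma_pos_of_pos (by linarith)
  positivity

/-! ### Lipschitz functions with bounded support -/

/-- In polar coordinates the integrand is r^(1-2s) near 0, integrable because s < 1, and r^(-1-2s)
at infinity, integrable because s > 0. -/
theorem integrable_min_mul_rpow [NeZero n] {s : ℝ} (hs0 : 0 < s) (hs1 : s < 1) :
    Integrable fun z : EuclideanSpace ℝ (Fin n) =>
      min (‖z‖ ^ 2) 1 * (‖z‖ ^ ((n : ℝ) + 2 * s))⁻¹ := by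
  have hn : 1 ≤ n := NeZero.one_le
  have key := integrable_fun_norm_addHaar (E := EuclideanSpace ℝ (Fin n)) (volume)
    (f := fun r : ℝ => min (r ^ 2) 1 * (r ^ ((n : ℝ) + 2 * s))⁻¹)
  rw [key]
  rw [finrank_euclideanSpace_fin]
  have hpow : ∀ r : ℝ, 0 < r → r ^ (n - 1) * (r ^ ((n : ℝ) + 2 * s))⁻¹ = r ^ (-1 - 2 * s) := by
    intro r hr
    rw [← Real.rpow_natCast, ← Real.rpow_neg hr.le, ← Real.rpow_add hr, Nat.cast_sub hn]
    congr 1; push_cast; ring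
  rw [← Set.Ioc_union_Ioi_eq_Ioi (zero_le_one' ℝ)]
  refine IntegrableOn.union ?_ ?_
  · have h : IntegrableOn (fun r : ℝ => r ^ (1 - 2 * s)) (Set.Ioc 0 1) :=
      (intervalIntegrable_iff_integrableOn_Ioc_of_le zero_le_one).1
        (intervalIntegral.intervalIntegrable_rpow' (by linarith))
    refine h.congr_fun (fun r hr => ?_) measurableSet_Ioc
    have h1 : min (r ^ 2) 1 = r ^ 2 := min_eq_left (by nlinarith [hr.1, hr.2])
    simp only [smul_eq_mul]
    rw [h1, mul_left_comm, hpow r hr.1, ← Real.rpow_natCast, ← Real.rpow_add hr.1]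
    congr 1; push_cast; ring
  · have h : IntegrableOn (fun r : ℝ => r ^ (-1 - 2 * s)) (Set.Ioi 1) :=
      integrableOn_Ioi_rpow_of_lt (by linarith) one_pos
    refine h.congr_fun (fun r hr => ?_) measurableSet_Ioi
    have hr1 : (1 : ℝ) < r := hr
    have h1 : min (r ^ 2) 1 = 1 := min_eq_right (by nlinarith)
    simp only [smul_eq_mul]
    rw [h1, one_mul, hpow r (by linarith)]

/-- A bounded function which vanishes outside a set of finite measure and is Lipschitz from every
point of that set belongs to `H^s`. -/
theorem memHs_of_lipschitz [NeZero n] {s : ℝ} (hs0 : 0 < s) (hs1 : s < 1)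
    {f : EuclideanSpace ℝ (Fin n) → ℝ} {S : Set (EuclideanSpace ℝ (Fin n))} {C : ℝ}
    (hf : AEStronglyMeasurable f) (hS : MeasurableSet S) (hSfin : volume S < ∞)
    (hzero : ∀ x ∉ S, f x = 0) (hbdd : ∀ x, |f x| ≤ C)
    (hlip : ∀ x ∈ S, ∀ y, |f x - f y| ≤ C * ‖x - y‖) : MemHs s f := by
  have hC : 0 ≤ C := (abs_nonneg _).trans (hbdd 0)
  rw [memHs_iff]
  have hind : Integrable (S.indicator fun _ => (1 : ℝ)) :=
    (integrable_indicator_iff hS).2 (integrableOn_const hSfin.ne)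
  have hLp : MemLp (S.indicator fun _ => (1 : ℝ)) 2 volume :=
    memLp_indicator_const 2 hS 1 (Or.inr hSfin.ne)
  refine ⟨(hLp.const_mul C).mono hf (Eventually.of_forall fun x => ?_), ?_⟩
  · by_cases hx : x ∈ S
    · simpa [hx, abs_of_nonneg hC] using hbdd x
    · rw [hzero x hx, norm_zero]; positivity
  have hprod : Integrable (fun p : EuclideanSpace ℝ (Fin n) × EuclideanSpace ℝ (Fin n) =>
      S.indicator (fun _ => (1 : ℝ)) p.1 *
        (min (‖p.2‖ ^ 2) 1 * (‖p.2‖ ^ ((n : ℝ) + 2 * s))⁻¹)) :=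
    hind.mul_prod (integrable_min_mul_rpow hs0 hs1)
  -- The shear (x, y) ↦ (x, y - x) turns a product of integrable functions into this one. The
  -- swapped copy covers pairs whose second point lies in `S`.
  have h1 : Integrable (fun p : EuclideanSpace ℝ (Fin n) × EuclideanSpace ℝ (Fin n) =>
      S.indicator (fun _ => (1 : ℝ)) p.1 * (min (‖p.1 - p.2‖ ^ 2) 1 * kern s p.1 p.2)) := by
    have hmp : MeasurePreserving (fun p : EuclideanSpace ℝ (Fin n) × EuclideanSpace ℝ (Fin n) =>
      (p.1, p.2 - p.1)) volume volume :=
        measurePreserving_prod_sub _ _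
    have := (hmp.integrable_comp hprod.1).2 hprod
    refine this.congr (Eventually.of_forall fun p => ?_)
    simp only [Function.comp, kern, norm_sub_rev p.2 p.1]
  have h2 := h1.swap
  refine (((h1.add h2).const_mul (4 * C ^ 2))).mono' ?_ (Eventually.of_forall fun p => ?_)
  · exact ((aestronglyMeasurable_sub_fst_snd hf).pow 2).mul
      (measurable_kern s).aestronglyMeasurable
  have hmain : ∀ x y : EuclideanSpace ℝ (Fin n), x ∈ S →
      (f x - f y) ^ 2 ≤ 4 * C ^ 2 * min (‖x - y‖ ^ 2) 1 := by
    intro x y hx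
    rcases min_cases (‖x - y‖ ^ 2) 1 with h | h
    · rw [h.1]
      have := hlip x hx y
      rw [← sq_abs]
      nlinarith [abs_nonneg (f x - f y), mul_nonneg hC (norm_nonneg (x - y))]
    · rw [h.1]
      have h3 : |f x - f y| ≤ 2 * C := by
        have := abs_sub (f x) (f y); linarith [hbdd x, hbdd y]
      rw [← sq_abs]
      nlinarith [abs_nonneg (f x - f y)]
  have hk := kern_nonneg s p.1 p.2
  have hm0 : 0 ≤ min (‖p.1 - p.2‖ ^ 2) 1 := by positivity
  rw [Real.norm_of_nonneg (mul_nonneg (sq_nonneg _) hk)]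
  simp only [Pi.add_apply, Function.comp, Prod.fst_swap, Prod.snd_swap, norm_sub_rev p.2 p.1,
    kern_symm s p.2 p.1]
  rw [← add_mul, ← mul_assoc, ← mul_assoc]
  have hi : ∀ x, 0 ≤ S.indicator (fun _ => (1 : ℝ)) x :=
    fun x => Set.indicator_nonneg (fun _ _ => zero_le_one) x
  refine (mul_le_mul_of_nonneg_right (?_ : _ ≤ 4 * C ^ 2 *
    (S.indicator (fun _ => (1 : ℝ)) p.1 + S.indicator (fun _ => (1 : ℝ)) p.2) *
      min (‖p.1 - p.2‖ ^ 2) 1) hk)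
  have hnn : 0 ≤ 4 * C ^ 2 * min (‖p.1 - p.2‖ ^ 2) 1 := by positivity
  by_cases hx : p.1 ∈ S
  · have := hmain p.1 p.2 hx
    rw [Set.indicator_of_mem hx]
    nlinarith [mul_nonneg hnn (hi p.2)]
  · by_cases hy : p.2 ∈ S
    · have := hmain p.2 p.1 hy
      rw [norm_sub_rev] at this
      rw [Set.indicator_of_mem hy]
      nlinarith [mul_nonneg hnn (hi p.1)]
    · simp [hzero _ hx, hzero _ hy, hx, hy]

end

section

variable {n : ℕ} [NeZero n]

/-! ### The negative part on the half-space -/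

theorem measurableSet_halfSpace : MeasurableSet (halfSpace n) :=
  (isOpen_lt continuous_const (by fun_prop : Continuous fun x : EuclideanSpace ℝ (Fin n) => x 0)
    ).measurableSet

/-- The negative part of `w` on the half-space `ℝⁿ₊`, extended by `0`. -/
def halfNegPart (w : EuclideanSpace ℝ (Fin n) → ℝ) : EuclideanSpace ℝ (Fin n) → ℝ :=
  (halfSpace n).indicator fun x => max (-(w x)) 0

variable {w : EuclideanSpace ℝ (Fin n) → ℝ}

theorem halfNegPart_of_pos {x : EuclideanSpace ℝ (Fin n)} (hx : 0 < x 0) :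
    halfNegPart w x = max (-(w x)) 0 :=
  Set.indicator_of_mem (s := halfSpace n) hx _

theorem halfNegPart_of_nonpos {x : EuclideanSpace ℝ (Fin n)} (hx : x 0 ≤ 0) :
    halfNegPart w x = 0 :=
  Set.indicator_of_notMem (s := halfSpace n) (not_lt.2 hx) _

theorem halfNegPart_nonneg (x : EuclideanSpace ℝ (Fin n)) : 0 ≤ halfNegPart w x :=
  Set.indicator_nonneg (fun _ _ => le_max_right _ _) x

theorem halfNegPart_sq_le (x : EuclideanSpace ℝ (Fin n)) : halfNegPart w x ^ 2 ≤ w x ^ 2 := by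
  rcases le_or_gt (x 0) 0 with h | h
  · rw [halfNegPart_of_nonpos h]; simpa using sq_nonneg (w x)
  · rw [halfNegPart_of_pos h]
    rcases max_cases (-(w x)) 0 with h1 | h1 <;> rw [h1.1]
    · simp
    · simpa using sq_nonneg (w x)

theorem mul_halfNegPart_nonpos (x : EuclideanSpace ℝ (Fin n)) : w x * halfNegPart w x ≤ 0 := by
  rcases le_or_gt (x 0) 0 with h | h
  · rw [halfNegPart_of_nonpos h, mul_zero]
  · rw [halfNegPart_of_pos h]
    rcases max_cases (-(w x)) 0 with h1 | h1 <;> rw [h1.1]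
    · nlinarith [sq_nonneg (w x)]
    · simp

theorem aestronglyMeasurable_halfNegPart (hw : AEStronglyMeasurable w) :
    AEStronglyMeasurable (halfNegPart w) :=
  (hw.neg.sup aestronglyMeasurable_const).indicator measurableSet_halfSpace

/-- Cutting off at a hyperplane can leave H^s when s ≥ 1/2; antisymmetry prevents this. For points
on opposite sides the kernel at the reflected pair is the larger one, and (a - b)² + (a + b)² = 2(a²
+ b²) controls both values. On the same side the negative part is 1-Lipschitz. -/
theorem sq_sub_halfNegPart_mul_kern_le {s : ℝ} (hs : 0 < s) (hw : IsAntisymmetric w)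
    {x y : EuclideanSpace ℝ (Fin n)} (hne : x ≠ reflect n y) :
    (halfNegPart w x - halfNegPart w y) ^ 2 * kern s x y ≤
      (w x - w y) ^ 2 * kern s x y + (w x - w (reflect n y)) ^ 2 * kern s x (reflect n y) := by
  have hk := kern_nonneg s x y
  have hk' := kern_nonneg s x (reflect n y)
  have hkr := kern_le_reflect (x := x) (y := y) hs hne
  rw [hw.reflect]
  have hx := halfNegPart_sq_le (w := w) x
  have hy := halfNegPart_sq_le (w := w) y
  have mixed : x 0 * y 0 ≤ 0 → (halfNegPart w x - halfNegPart w y) ^ 2 ≤ w x ^ 2 + w y ^ 2 →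
      (halfNegPart w x - halfNegPart w y) ^ 2 * kern s x y ≤
      (w x - w y) ^ 2 * kern s x y + (w x - -w y) ^ 2 * kern s x (reflect n y) := by
    intro h1 h2
    have h3 := hkr h1
    nlinarith [mul_le_mul_of_nonneg_left h3 (sq_nonneg (w x + w y)),
      mul_le_mul_of_nonneg_right h2 hk, mul_nonneg hk (sq_nonneg (w x)),
      mul_nonneg hk (sq_nonneg (w y))]
  rcases le_or_gt (x 0) 0 with h | h <;> rcases le_or_gt (y 0) 0 with h' | h'
  · rw [halfNegPart_of_nonpos h, halfNegPart_of_nonpos h', sub_self]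
    have := mul_nonneg (sq_nonneg (w x - w y)) hk
    have := mul_nonneg (sq_nonneg (w x - -w y)) hk'
    linarith
  · refine mixed (mul_nonpos_of_nonpos_of_nonneg h h'.le) ?_
    rw [halfNegPart_of_nonpos h, zero_sub, neg_sq]
    nlinarith [sq_nonneg (w x)]
  · refine mixed (mul_nonpos_of_nonneg_of_nonpos h.le h') ?_
    rw [halfNegPart_of_nonpos h', sub_zero]
    nlinarith [sq_nonneg (w y)]
  · have h1 : (halfNegPart w x - halfNegPart w y) ^ 2 ≤ (w x - w y) ^ 2 := by
      rw [halfNegPart_of_pos h, halfNegPart_of_pos h', sq_le_sq]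
      refine (abs_max_sub_max_le_abs _ _ _).trans (le_of_eq ?_)
      rw [← abs_neg]; congr 1; ring
    nlinarith [mul_le_mul_of_nonneg_right h1 hk, mul_nonneg (sq_nonneg (w x - -w y)) hk']

theorem memHs_halfNegPart {s : ℝ} (hs : 0 < s) (hw : IsAntisymmetric w) (hwH : MemHs s w) :
    MemHs s (halfNegPart w) := by
  rw [memHs_iff] at *
  have hm := aestronglyMeasurable_halfNegPart hwH.1.1
  refine ⟨hwH.1.mono hm (Eventually.of_forall fun x => ?_), ?_⟩
  · exact sq_le_sq.1 (halfNegPart_sq_le x)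
  have hR := (measurePreserving_reflect_snd.integrable_comp hwH.2.1).2 hwH.2
  refine (hwH.2.add hR).mono' (((aestronglyMeasurable_sub_fst_snd hm).pow 2).mul
    (measurable_kern s).aestronglyMeasurable) ?_
  have hae : ∀ᵐ p : EuclideanSpace ℝ (Fin n) × EuclideanSpace ℝ (Fin n),
      p.1 ≠ reflect n p.2 :=
    measurePreserving_reflect_snd.quasiMeasurePreserving.ae (ae_fst_ne_snd (n := n))
  filter_upwards [hae] with p hp
  rw [Real.norm_of_nonneg (mul_nonneg (sq_nonneg _) (kern_nonneg _ _ _))]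
  exact sq_sub_halfNegPart_mul_kern_le hs hw hp

/-! ### The weak maximum principle for the bilinear form -/

/-- The first product is nonpositive since the negative part is decreasing, so `k` may be lowered to
`k'`. The sum then becomes 2k'(a a⁻ + b b⁻) ≤ 0. -/
theorem sub_mul_sub_add_mul_add_nonpos {a b k k' : ℝ} (hk' : 0 ≤ k') (hk : k' ≤ k) :
    (a - b) * (max (-a) 0 - max (-b) 0) * k + (a + b) * (max (-a) 0 + max (-b) 0) * k' ≤ 0 := by
  have h1 : (a - b) * (max (-a) 0 - max (-b) 0) ≤ 0 := by
    rcases le_total a b with h | h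
    · exact mul_nonpos_of_nonpos_of_nonneg (by linarith)
        (sub_nonneg.2 (max_le_max_right 0 (by linarith)))
    · exact mul_nonpos_of_nonneg_of_nonpos (by linarith)
        (sub_nonpos.2 (max_le_max_right 0 (by linarith)))
  have h2 : ∀ c : ℝ, c * max (-c) 0 ≤ 0 := by
    intro c
    rcases max_cases (-c) 0 with h | h <;> rw [h.1] <;> nlinarith [sq_nonneg c]
  nlinarith [mul_nonneg_of_nonpos_of_nonpos h1 (sub_nonpos.2 hk),
    mul_nonneg_of_nonpos_of_nonpos (h2 a) (neg_nonpos.2 hk'),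
    mul_nonneg_of_nonpos_of_nonpos (h2 b) (neg_nonpos.2 hk')]

/-- The sum of `F` over the orbit of `(x, y)` under the reflections of both variables. -/
def reflectSum (F : EuclideanSpace ℝ (Fin n) × EuclideanSpace ℝ (Fin n) → ℝ)
    (p : EuclideanSpace ℝ (Fin n) × EuclideanSpace ℝ (Fin n)) : ℝ :=
  F p + F (reflect n p.1, p.2) + F (p.1, reflect n p.2) + F (reflect n p.1, reflect n p.2)

theorem reflectSum_reflect_fst (F : EuclideanSpace ℝ (Fin n) × EuclideanSpace ℝ (Fin n) → ℝ)
    (x y : EuclideanSpace ℝ (Fin n)) : reflectSum F (reflect n x, y) = reflectSum F (x, y) := by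
  simp only [reflectSum, reflect_reflect]; ring

theorem reflectSum_reflect_snd (F : EuclideanSpace ℝ (Fin n) × EuclideanSpace ℝ (Fin n) → ℝ)
    (x y : EuclideanSpace ℝ (Fin n)) : reflectSum F (x, reflect n y) = reflectSum F (x, y) := by
  simp only [reflectSum, reflect_reflect]; ring

theorem integral_reflectSum {F : EuclideanSpace ℝ (Fin n) × EuclideanSpace ℝ (Fin n) → ℝ}
    (hF : Integrable F) : ∫ p, reflectSum F p = 4 * ∫ p, F p := by
  have h1 : Integrable (fun p : EuclideanSpace ℝ (Fin n) × EuclideanSpace ℝ (Fin n) =>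
      F (reflect n p.1, p.2)) := (measurePreserving_reflect_fst.integrable_comp hF.1).2 hF
  have h2 : Integrable (fun p : EuclideanSpace ℝ (Fin n) × EuclideanSpace ℝ (Fin n) =>
      F (p.1, reflect n p.2)) := (measurePreserving_reflect_snd.integrable_comp hF.1).2 hF
  have h3 : Integrable (fun p : EuclideanSpace ℝ (Fin n) × EuclideanSpace ℝ (Fin n) =>
      F (reflect n p.1, reflect n p.2)) :=
    (measurePreserving_reflect_fst.integrable_comp h2.1).2 h2
  have e1 : ∫ p : EuclideanSpace ℝ (Fin n) × EuclideanSpace ℝ (Fin n),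
      F (reflect n p.1, p.2) = ∫ p, F p :=
    measurePreserving_reflect_fst.integral_comp measurableEmbedding_reflect_fst F
  have e2 : ∫ p : EuclideanSpace ℝ (Fin n) × EuclideanSpace ℝ (Fin n),
      F (p.1, reflect n p.2) = ∫ p, F p :=
    measurePreserving_reflect_snd.integral_comp measurableEmbedding_reflect_snd F
  have e3 : ∫ p : EuclideanSpace ℝ (Fin n) × EuclideanSpace ℝ (Fin n),
      F (reflect n p.1, reflect n p.2) = ∫ p, F p := by
    rw [← e2]
    exact measurePreserving_reflect_fst.integral_comp measurableEmbedding_reflect_fst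
      (fun p => F (p.1, reflect n p.2))
  have h01 : Integrable (fun p : EuclideanSpace ℝ (Fin n) × EuclideanSpace ℝ (Fin n) =>
      F p + F (reflect n p.1, p.2)) := hF.add h1
  have h012 : Integrable (fun p : EuclideanSpace ℝ (Fin n) × EuclideanSpace ℝ (Fin n) =>
      F p + F (reflect n p.1, p.2) + F (p.1, reflect n p.2)) := h01.add h2
  unfold reflectSum
  rw [integral_add h012 h3, integral_add h01 h2, integral_add hF h1, e1, e2, e3]
  ring

/-- The orbit sum is invariant under reflecting either point, so both may be taken in the closed
half-space. There the four terms collapse to the expression of `sub_mul_sub_add_mul_add_nonpos`,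
with the kernels at (x, y) and at (x, reflected y). -/
theorem reflectSum_energyDensity_nonpos {s : ℝ} (hs : 0 < s) (hw : IsAntisymmetric w)
    {x y : EuclideanSpace ℝ (Fin n)} (hne : x ≠ y) (hne' : x ≠ reflect n y) :
    reflectSum (energyDensity s w (halfNegPart w)) (x, y) ≤ 0 := by
  have hpos : ∀ {x y : EuclideanSpace ℝ (Fin n)}, x ≠ y → 0 ≤ x 0 → 0 ≤ y 0 →
      reflectSum (energyDensity s w (halfNegPart w)) (x, y) ≤ 0 := by
    intro x y hne hx hy
    -- On the hyperplane itself antisymmetry forces `w` to vanish, so the formula extends to the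
    -- boundary.
    have hval : ∀ z : EuclideanSpace ℝ (Fin n), 0 ≤ z 0 →
        halfNegPart w z = max (-(w z)) 0 := by
      intro z hz
      rcases hz.eq_or_lt with h | h
      · have h0 : reflect n z = z := by rw [reflect_apply, ← h]; simp
        have h1 := hw.reflect z
        rw [h0] at h1
        have h2 : w z = 0 := by linarith
        rw [halfNegPart_of_nonpos h.ge, h2]; simp
      · exact halfNegPart_of_pos h
    have hzero : ∀ z : EuclideanSpace ℝ (Fin n), 0 ≤ z 0 → halfNegPart w (reflect n z) = 0 :=
      fun z hz => halfNegPart_of_nonpos (by rw [reflect_coord]; linarith)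
    have := sub_mul_sub_add_mul_add_nonpos (a := w x) (b := w y) (kern_nonneg s x (reflect n y))
      (kern_reflect_le hs hne (mul_nonneg hx hy))
    simp only [reflectSum, energyDensity, hw.reflect, hzero x hx, hzero y hy, hval x hx, hval y hy,
      kern_reflect_left, reflect_reflect]
    linarith
  have hinj := (reflect n).injective
  rcases le_total 0 (x 0) with hx | hx <;> rcases le_total 0 (y 0) with hy | hy
  · exact hpos hne hx hy
  · rw [← reflectSum_reflect_snd]
    exact hpos hne' hx (by rw [reflect_coord]; linarith)
  · rw [← reflectSum_reflect_fst]
    refine hpos (fun h => hne' ?_) (by rw [reflect_coord]; linarith) hy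
    rw [← h, reflect_reflect]
  · rw [← reflectSum_reflect_fst, ← reflectSum_reflect_snd]
    exact hpos (hinj.ne hne) (by rw [reflect_coord]; linarith) (by rw [reflect_coord]; linarith)

theorem energy_halfNegPart_nonpos {s : ℝ} (hs0 : 0 < s) (hs1 : s < 1) (hw : IsAntisymmetric w)
    (hwH : MemHs s w) : energy s w (halfNegPart w) ≤ 0 := by
  rw [energy_eq]
  refine mul_nonpos_of_nonneg_of_nonpos (by linarith [fracConst_pos (n := n) hs0 hs1]) ?_
  have h := integral_reflectSum (hwH.integrable_energyDensity (memHs_halfNegPart hs0 hw hwH))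
  have hae : ∀ᵐ p : EuclideanSpace ℝ (Fin n) × EuclideanSpace ℝ (Fin n),
      p.1 ≠ reflect n p.2 :=
    measurePreserving_reflect_snd.quasiMeasurePreserving.ae (ae_fst_ne_snd (n := n))
  have h2 : ∫ p, reflectSum (energyDensity s w (halfNegPart w)) p ≤ 0 := by
    refine integral_nonpos_of_ae ?_
    filter_upwards [hae, ae_fst_ne_snd (n := n)] with p h1 h2
    exact reflectSum_energyDensity_nonpos hs0 hw h2 h1
  linarith

end

section

variable {n : ℕ}

/-! ### The bilinear form through second differences -/

/-- The second difference `2 f(x) - f(x+z) - f(x-z)`. -/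
def secondDiff (f : EuclideanSpace ℝ (Fin n) → ℝ) (x z : EuclideanSpace ℝ (Fin n)) : ℝ :=
  2 * f x - f (x + z) - f (x - z)

theorem memLp_comp_add_right {φ : EuclideanSpace ℝ (Fin n) → ℝ} (hφ : MemLp φ 2 volume)
    (z : EuclideanSpace ℝ (Fin n)) : MemLp (fun x => φ (x + z)) 2 volume :=
  hφ.comp_measurePreserving (measurePreserving_add_right volume z)

theorem integrable_secondDiff_mul {φ v : EuclideanSpace ℝ (Fin n) → ℝ} (hφ : MemLp φ 2 volume)
    (hv : MemLp v 2 volume) (z : EuclideanSpace ℝ (Fin n)) :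
    Integrable fun x => secondDiff φ x z * v x := by
  have h : MemLp (fun x => secondDiff φ x z) 2 volume := by
    have h1 := ((hφ.const_mul 2).sub (memLp_comp_add_right hφ z)).sub
      (memLp_comp_add_right hφ (-z))
    exact h1.ae_eq (Eventually.of_forall fun x => by simp [secondDiff, sub_eq_add_neg])
  exact h.integrable_mul hv

/-- Discrete integration by parts: translating by `z` in the term containing v(x + z) moves both
differences onto `φ`. -/
theorem integral_sub_mul_sub {φ v : EuclideanSpace ℝ (Fin n) → ℝ} (hφ : MemLp φ 2 volume)
    (hv : MemLp v 2 volume) (z : EuclideanSpace ℝ (Fin n)) :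
    ∫ x, (φ x - φ (x + z)) * (v x - v (x + z)) = ∫ x, secondDiff φ x z * v x := by
  have h1 : Integrable fun x => (φ x - φ (x + z)) * v x :=
    (hφ.sub (memLp_comp_add_right hφ z)).integrable_mul hv
  have h2 : Integrable fun x => (φ x - φ (x + z)) * v (x + z) :=
    (hφ.sub (memLp_comp_add_right hφ z)).integrable_mul (memLp_comp_add_right hv z)
  have h3 : Integrable fun x => (φ (x - z) - φ x) * v x := by
    have h := ((memLp_comp_add_right hφ (-z)).sub hφ).integrable_mul hv
    exact h.congr (Eventually.of_forall fun x => by simp [sub_eq_add_neg])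
  have e2 : ∫ x, (φ x - φ (x + z)) * v (x + z) = ∫ x, (φ (x - z) - φ x) * v x := by
    rw [← integral_add_right_eq_self (fun x => (φ (x - z) - φ x) * v x) z]
    simp only [add_sub_cancel_right]
  calc ∫ x, (φ x - φ (x + z)) * (v x - v (x + z))
      = ∫ x, ((φ x - φ (x + z)) * v x - (φ x - φ (x + z)) * v (x + z)) := by
        congr 1; funext x; ring
    _ = ∫ x, ((φ x - φ (x + z)) * v x - (φ (x - z) - φ x) * v x) := by
        rw [integral_sub h1 h2, e2, integral_sub h1 h3]
    _ = _ := by congr 1; funext x; rw [secondDiff]; ring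

/-- Substitute y = x + z and integrate over x first. Keeping z outermost avoids defining the
fractional Laplacian of `φ` pointwise and lets z be paired with its reflection. -/
theorem integral_energyDensity {s : ℝ} {φ v : EuclideanSpace ℝ (Fin n) → ℝ} (hφ : MemHs s φ)
    (hv : MemHs s v) :
    Integrable (fun z : EuclideanSpace ℝ (Fin n) =>
      (‖z‖ ^ ((n : ℝ) + 2 * s))⁻¹ * ∫ x, secondDiff φ x z * v x) ∧
    ∫ p, energyDensity s φ v p = ∫ z : EuclideanSpace ℝ (Fin n),
      (‖z‖ ^ ((n : ℝ) + 2 * s))⁻¹ * ∫ x, secondDiff φ x z * v x := by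
  have hmp : MeasurePreserving (fun p : EuclideanSpace ℝ (Fin n) × EuclideanSpace ℝ (Fin n) =>
      (p.1, p.1 + p.2)) volume volume := measurePreserving_prod_add _ _
  have hemb : MeasurableEmbedding (fun p : EuclideanSpace ℝ (Fin n) × EuclideanSpace ℝ (Fin n) =>
      (p.1, p.1 + p.2)) :=
    (MeasurableEquiv.shearAddRight (EuclideanSpace ℝ (Fin n))).measurableEmbedding
  have hint := hφ.integrable_energyDensity hv
  have hcomp : Integrable (fun p : EuclideanSpace ℝ (Fin n) × EuclideanSpace ℝ (Fin n) =>
      energyDensity s φ v (p.1, p.1 + p.2)) := (hmp.integrable_comp hint.1).2 hint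
  have hinner : ∀ z : EuclideanSpace ℝ (Fin n),
      ∫ x, energyDensity s φ v (x, x + z) =
      (‖z‖ ^ ((n : ℝ) + 2 * s))⁻¹ * ∫ x, secondDiff φ x z * v x := by
    intro z
    rw [← integral_sub_mul_sub hφ.1 hv.1, ← integral_const_mul]
    congr 1; funext x
    simp only [energyDensity, kern, sub_add_cancel_left, norm_neg]
    ring
  have hI := hcomp.integral_prod_right
  simp only [hinner] at hI
  refine ⟨hI, ?_⟩
  rw [← hmp.integral_comp hemb, Measure.volume_eq_prod, integral_prod_symm _ hcomp]
  simp only [hinner]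

/-! ### The bump function -/

/-- The function `(1/64 - |x|²)₊`, supported in the ball of radius `1/8`. -/
def bump (x : EuclideanSpace ℝ (Fin n)) : ℝ := max (1 / 64 - ‖x‖ ^ 2) 0

theorem bump_nonneg (x : EuclideanSpace ℝ (Fin n)) : 0 ≤ bump x := le_max_right _ _

theorem le_bump (x : EuclideanSpace ℝ (Fin n)) : 1 / 64 - ‖x‖ ^ 2 ≤ bump x := le_max_left _ _

theorem bump_le (x : EuclideanSpace ℝ (Fin n)) : bump x ≤ 1 / 64 :=
  max_le (by nlinarith [sq_nonneg ‖x‖]) (by norm_num)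

theorem bump_of_le {x : EuclideanSpace ℝ (Fin n)} (h : 1 / 8 ≤ ‖x‖) : bump x = 0 :=
  max_eq_right (by nlinarith)

theorem bump_of_lt {x : EuclideanSpace ℝ (Fin n)} (h : ‖x‖ < 1 / 8) :
    bump x = 1 / 64 - ‖x‖ ^ 2 :=
  max_eq_left (by nlinarith [norm_nonneg x])

theorem continuous_bump : Continuous (bump : EuclideanSpace ℝ (Fin n) → ℝ) := by
  unfold bump; fun_prop

theorem abs_bump_sub_bump_le_sq (x y : EuclideanSpace ℝ (Fin n)) :
    |bump x - bump y| ≤ |‖x‖ ^ 2 - ‖y‖ ^ 2| := by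
  refine (abs_max_sub_max_le_abs _ _ _).trans (le_of_eq ?_)
  rw [← abs_neg]; congr 1; ring

theorem abs_bump_sub_bump_le (x y : EuclideanSpace ℝ (Fin n)) :
    |bump x - bump y| ≤ 1 / 4 * ‖x - y‖ := by
  have key : ∀ x y : EuclideanSpace ℝ (Fin n), bump x - bump y ≤ 1 / 4 * ‖x - y‖ := by
    intro x y
    rcases le_or_gt (1 / 8) ‖x‖ with hx | hx
    · rw [bump_of_le hx]
      linarith [bump_nonneg y, norm_nonneg (x - y)]
    · have h1 : ‖y‖ ≤ ‖x‖ + ‖x - y‖ := by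
        have := norm_sub_norm_le y x
        rw [norm_sub_rev] at this; linarith
      rw [bump_of_lt hx]
      rcases le_or_gt (1 / 8) ‖y‖ with hy | hy
      · rw [bump_of_le hy]
        nlinarith [norm_nonneg x]
      · rw [bump_of_lt hy]
        rcases le_total ‖y‖ ‖x‖ with h | h
        · nlinarith [norm_nonneg x, norm_nonneg y, norm_nonneg (x - y)]
        · nlinarith [norm_nonneg x, norm_nonneg y, norm_nonneg (x - y)]
  rw [abs_le]
  constructor
  · have := key y x
    rw [norm_sub_rev] at this
    linarith
  · exact key x y

variable [NeZero n]

/-- The half-ball of radius `1/8`. -/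
def smallHalfBall (n : ℕ) [NeZero n] : Set (EuclideanSpace ℝ (Fin n)) :=
  Metric.ball 0 (1 / 8) ∩ halfSpace n

theorem measurableSet_smallHalfBall : MeasurableSet (smallHalfBall n) :=
  measurableSet_ball.inter measurableSet_halfSpace

/-! ### The barrier near the origin -/

/-- The antisymmetric function `x₁ (1/64 - |x|²)₊`. -/
def coordBump (x : EuclideanSpace ℝ (Fin n)) : ℝ := x 0 * bump x

theorem continuous_coordBump : Continuous (coordBump : EuclideanSpace ℝ (Fin n) → ℝ) := by
  have := continuous_bump (n := n)
  unfold coordBump; fun_prop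

theorem coordBump_reflect (x : EuclideanSpace ℝ (Fin n)) :
    coordBump (reflect n x) = - coordBump x := by
  rw [coordBump, coordBump, reflect_coord, bump, bump, (reflect n).norm_map]; ring

theorem memHs_coordBump {s : ℝ} (hs0 : 0 < s) (hs1 : s < 1) :
    MemHs s (coordBump : EuclideanSpace ℝ (Fin n) → ℝ) := by
  refine memHs_of_lipschitz (S := Metric.ball 0 (1 / 8)) (C := 1) hs0 hs1
    continuous_coordBump.aestronglyMeasurable measurableSet_ball measure_ball_lt_top ?_ ?_ ?_
  · intro x hx
    rw [mem_ball_zero_iff, not_lt] at hx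
    rw [coordBump, bump_of_le hx, mul_zero]
  · intro x
    rw [coordBump, abs_mul, abs_of_nonneg (bump_nonneg x)]
    rcases le_or_gt (1 / 8) ‖x‖ with hx | hx
    · rw [bump_of_le hx]; simp
    · nlinarith [abs_coord_le_norm x, bump_le x, bump_nonneg x, abs_nonneg (x 0)]
  · intro x hx y
    rw [mem_ball_zero_iff] at hx
    have h : coordBump x - coordBump y = x 0 * (bump x - bump y) + (x - y) 0 * bump y := by
      rw [coordBump, coordBump, PiLp.sub_apply]; ring
    rw [h]
    refine (abs_add_le _ _).trans ?_
    rw [abs_mul, abs_mul, abs_of_nonneg (bump_nonneg y)]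
    have h1 := abs_bump_sub_bump_le x y
    have h2 := abs_coord_le_norm x
    have h3 := abs_coord_le_norm (x - y)
    have h4 := bump_le y
    have h5 := bump_nonneg y
    have h6 : |x 0| * |bump x - bump y| ≤ 1 / 8 * (1 / 4 * ‖x - y‖) :=
      mul_le_mul (by linarith) h1 (abs_nonneg _) (by norm_num)
    have h7 : |(x - y) 0| * bump y ≤ ‖x - y‖ * (1 / 64) :=
      mul_le_mul h3 h4 h5 (norm_nonneg _)
    linarith [norm_nonneg (x - y)]

/-- The bound must carry the factor x₁, which a single second difference need not supply: it
contains z₁ times a difference of bumps. Pairing z with its reflection flips z₁, leaving bump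
differences at points whose squared norms differ by 4x₁z₁. The constant is 12 = 4 + 8, from the
paraboloid and from these differences. -/
theorem secondDiff_coordBump_le {x : EuclideanSpace ℝ (Fin n)} (hx : x ∈ smallHalfBall n)
    (z : EuclideanSpace ℝ (Fin n)) :
    secondDiff coordBump x z + secondDiff coordBump x (reflect n z) ≤
      12 * min (‖z‖ ^ 2) 1 * x 0 := by
  have hxn : ‖x‖ < 1 / 8 := mem_ball_zero_iff.1 hx.1
  have hx0 : 0 < x 0 := hx.2
  set R := reflect n with hR
  have hexp : secondDiff coordBump x z + secondDiff coordBump x (R z) =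
      x 0 * (4 * bump x - bump (x + z) - bump (x - z) - bump (x + R z) - bump (x - R z))
      - z 0 * ((bump (x + z) - bump (x + R z)) - (bump (x - z) - bump (x - R z))) := by
    simp only [secondDiff, coordBump, PiLp.add_apply, PiLp.sub_apply, hR, reflect_coord]
    ring
  rw [hexp]
  have hRz : ‖R z‖ = ‖z‖ := R.norm_map z
  rcases le_or_gt (‖z‖ ^ 2) 1 with hz | hz
  · rw [min_eq_left hz]
    have n1 := norm_add_sq_real x z
    have n2 := norm_sub_sq_real x z
    have n3 := norm_add_sq_real x (R z)
    have n4 := norm_sub_sq_real x (R z)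
    have ninner : inner ℝ x (R z) = inner ℝ x z - 2 * (x 0 * z 0) := by
      rw [hR, reflect_apply, inner_sub_right, inner_smul_right, inner_e₁]; ring
    rw [hRz, ninner] at n3 n4
    have b1 := le_bump (x + z)
    have b2 := le_bump (x - z)
    have b3 := le_bump (x + R z)
    have b4 := le_bump (x - R z)
    have b0 := bump_of_lt hxn
    have d1 : |bump (x + z) - bump (x + R z)| ≤ 4 * x 0 * |z 0| := by
      refine (abs_bump_sub_bump_le_sq _ _).trans (le_of_eq ?_)
      rw [n1, n3]
      rw [show ‖x‖ ^ 2 + 2 * inner ℝ x z + ‖z‖ ^ 2 -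
        (‖x‖ ^ 2 + 2 * (inner ℝ x z - 2 * (x 0 * z 0)) + ‖z‖ ^ 2) = 4 * x 0 * z 0 by ring,
        abs_mul, abs_of_pos (by positivity : 0 < 4 * x 0)]
    have d2 : |bump (x - z) - bump (x - R z)| ≤ 4 * x 0 * |z 0| := by
      refine (abs_bump_sub_bump_le_sq _ _).trans (le_of_eq ?_)
      rw [n2, n4]
      rw [show ‖x‖ ^ 2 - 2 * inner ℝ x z + ‖z‖ ^ 2 -
        (‖x‖ ^ 2 - 2 * (inner ℝ x z - 2 * (x 0 * z 0)) + ‖z‖ ^ 2) = -(4 * x 0 * z 0) by ring,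
        abs_neg, abs_mul, abs_of_pos (by positivity : 0 < 4 * x 0)]
    have t1 : x 0 * (4 * bump x - bump (x + z) - bump (x - z) - bump (x + R z) - bump (x - R z))
        ≤ x 0 * (4 * ‖z‖ ^ 2) := by
      refine mul_le_mul_of_nonneg_left ?_ hx0.le
      linarith
    have t2 : -(z 0 * ((bump (x + z) - bump (x + R z)) - (bump (x - z) - bump (x - R z)))) ≤
        8 * x 0 * ‖z‖ ^ 2 := by
      refine (neg_le_abs _).trans ?_
      rw [abs_mul]
      have h3 : |(bump (x + z) - bump (x + R z)) - (bump (x - z) - bump (x - R z))| ≤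
          8 * x 0 * |z 0| := by
        refine (abs_sub _ _).trans ?_
        linarith
      have h4 : |z 0| ^ 2 ≤ ‖z‖ ^ 2 := by
        have := abs_coord_le_norm z
        gcongr
      nlinarith [mul_le_mul_of_nonneg_left h3 (abs_nonneg (z 0)),
        mul_le_mul_of_nonneg_left h4 hx0.le]
    linarith
  · rw [min_eq_right hz.le]
    have hz1 : 1 < ‖z‖ := by
      by_contra h
      nlinarith [norm_nonneg z]
    have far : ∀ y : EuclideanSpace ℝ (Fin n), ‖y‖ = ‖z‖ → bump (x + y) = 0 ∧ bump (x - y) = 0 := by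
      intro y hy
      constructor
      · apply bump_of_le
        have := norm_sub_norm_le y (-x)
        rw [sub_neg_eq_add, norm_neg, add_comm y x] at this
        linarith
      · apply bump_of_le
        have := norm_sub_norm_le y x
        rw [norm_sub_rev] at this
        linarith
    rw [(far z rfl).1, (far z rfl).2, (far _ hRz).1, (far _ hRz).2]
    nlinarith [bump_le x]

/-! ### Estimates against test functions supported in the small half-ball -/

theorem integrable_of_ae_zero {v : EuclideanSpace ℝ (Fin n) → ℝ} (hv : MemLp v 2 volume)
    (hv0 : ∀ᵐ x, x ∉ smallHalfBall n → v x = 0) : Integrable v := by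
  have hfin : volume (smallHalfBall n) < ∞ :=
    (measure_mono Set.inter_subset_left).trans_lt measure_ball_lt_top
  have hf := memLp_indicator_const (μ := (volume : Measure (EuclideanSpace ℝ (Fin n)))) 2
    measurableSet_smallHalfBall (1 : ℝ) (Or.inr hfin.ne)
  refine (hf.integrable_mul hv).congr ?_
  filter_upwards [hv0] with x hx
  by_cases h : x ∈ smallHalfBall n
  · simp [h]
  · simp [hx h]

theorem integrable_coord_mul {v : EuclideanSpace ℝ (Fin n) → ℝ} (hv : MemLp v 2 volume)
    (hv0 : ∀ᵐ x, x ∉ smallHalfBall n → v x = 0) : Integrable fun x => x 0 * v x := by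
  refine (integrable_of_ae_zero hv hv0).norm.mono'
    ((by fun_prop : Continuous fun x : EuclideanSpace ℝ (Fin n) => x 0).aestronglyMeasurable.mul
      hv.1) ?_
  filter_upwards [hv0] with x hx
  by_cases h : x ∈ smallHalfBall n
  · have h1 : ‖x‖ < 1 / 8 := mem_ball_zero_iff.1 h.1
    have h2 := abs_coord_le_norm x
    rw [norm_mul, Real.norm_eq_abs (x 0)]
    nlinarith [norm_nonneg (v x)]
  · simp [hx h]

theorem integral_energyDensity_coordBump_le {s : ℝ} (hs0 : 0 < s) (hs1 : s < 1)
    {v : EuclideanSpace ℝ (Fin n) → ℝ} (hv : MemHs s v)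
    (hv0 : ∀ᵐ x, x ∉ smallHalfBall n → v x = 0) (hvn : ∀ x, 0 ≤ v x) :
    ∫ p, energyDensity s coordBump v p ≤
      6 * (∫ z : EuclideanSpace ℝ (Fin n), min (‖z‖ ^ 2) 1 * (‖z‖ ^ ((n : ℝ) + 2 * s))⁻¹) *
        ∫ x, x 0 * v x := by
  have hφ := memHs_coordBump (n := n) hs0 hs1
  obtain ⟨hI, hE⟩ := integral_energyDensity hφ hv
  rw [hE]
  have hIR := (measurePreserving_reflect.integrable_comp hI.1).2 hI
  have hRint := integral_comp_reflect (fun z : EuclideanSpace ℝ (Fin n) =>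
      (‖z‖ ^ ((n : ℝ) + 2 * s))⁻¹ * ∫ x, secondDiff coordBump x z * v x)
  -- The two integrals are equal, so the paired bound with constant 12 gives 6 for each.
  have hsum := integral_add hI hIR
  simp only [Function.comp] at hsum
  rw [hRint] at hsum
  have hbound : ∀ z : EuclideanSpace ℝ (Fin n),
      (‖z‖ ^ ((n : ℝ) + 2 * s))⁻¹ * (∫ x, secondDiff coordBump x z * v x) +
      (‖reflect n z‖ ^ ((n : ℝ) + 2 * s))⁻¹ * (∫ x, secondDiff coordBump x (reflect n z) * v x) ≤
      (min (‖z‖ ^ 2) 1 * (‖z‖ ^ ((n : ℝ) + 2 * s))⁻¹) * (12 * ∫ x, x 0 * v x) := by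
    intro z
    have hk : 0 ≤ (‖z‖ ^ ((n : ℝ) + 2 * s))⁻¹ := by positivity
    have h1 : (∫ x, secondDiff coordBump x z * v x) +
        (∫ x, secondDiff coordBump x (reflect n z) * v x) ≤
        ∫ x, 12 * min (‖z‖ ^ 2) 1 * (x 0 * v x) := by
      rw [← integral_add (integrable_secondDiff_mul hφ.1 hv.1 z)
        (integrable_secondDiff_mul hφ.1 hv.1 _)]
      refine integral_mono_ae ((integrable_secondDiff_mul hφ.1 hv.1 z).add
        (integrable_secondDiff_mul hφ.1 hv.1 _)) ((integrable_coord_mul hv.1 hv0).const_mul _) ?_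
      filter_upwards [hv0] with x hx
      by_cases h : x ∈ smallHalfBall n
      · have := mul_le_mul_of_nonneg_right (secondDiff_coordBump_le h z) (hvn x)
        linarith
      · simp [hx h]
    rw [integral_const_mul] at h1
    rw [(reflect n).norm_map, ← mul_add]
    calc _ ≤ _ := mul_le_mul_of_nonneg_left h1 hk
      _ = _ := by ring
  have hmono := integral_mono (hI.add hIR)
    ((integrable_min_mul_rpow hs0 hs1).mul_const (12 * ∫ x, x 0 * v x)) hbound
  simp only [Pi.add_apply, Function.comp] at hmono
  rw [integral_mul_const] at hmono
  linarith

end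

section

variable {n : ℕ} [NeZero n]

/-! ### The barrier away from the origin -/

/-- The bump function centred at `e₁ / 2`. -/
def farBump (x : EuclideanSpace ℝ (Fin n)) : ℝ := bump (x - (1 / 2 : ℝ) • e₁ n)

/-- The antisymmetrisation of `farBump`. -/
def oddFarBump (x : EuclideanSpace ℝ (Fin n)) : ℝ := farBump x - farBump (reflect n x)

theorem farBump_nonneg (x : EuclideanSpace ℝ (Fin n)) : 0 ≤ farBump x := bump_nonneg _

theorem continuous_farBump : Continuous (farBump : EuclideanSpace ℝ (Fin n) → ℝ) :=
  continuous_bump.comp (by fun_prop)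

theorem norm_sub_lt_of_farBump_ne_zero {x : EuclideanSpace ℝ (Fin n)} (h : farBump x ≠ 0) :
    ‖x - (1 / 2 : ℝ) • e₁ n‖ < 1 / 8 := by
  by_contra hc
  exact h (bump_of_le (not_lt.1 hc))

theorem coord_bounds {x : EuclideanSpace ℝ (Fin n)}
    (h : ‖x - (1 / 2 : ℝ) • e₁ n‖ ≤ 1 / 8) : 3 / 8 ≤ x 0 ∧ x 0 ≤ 5 / 8 ∧ ‖x‖ ≤ 5 / 8 := by
  have h1 := abs_le.1 (abs_coord_le_norm (x - (1 / 2 : ℝ) • e₁ n))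
  simp only [PiLp.sub_apply, PiLp.smul_apply, e₁_zero, smul_eq_mul] at h1
  have h2 := norm_sub_norm_le x ((1 / 2 : ℝ) • e₁ n)
  rw [norm_smul, norm_e₁, Real.norm_of_nonneg (by norm_num)] at h2
  refine ⟨?_, ?_, ?_⟩ <;> linarith [h1.1, h1.2]

theorem farBump_of_coord_lt {x : EuclideanSpace ℝ (Fin n)} (h : x 0 < 3 / 8) : farBump x = 0 := by
  by_contra hc
  linarith [(coord_bounds (norm_sub_lt_of_farBump_ne_zero hc).le).1]

theorem oddFarBump_reflect (x : EuclideanSpace ℝ (Fin n)) :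
    oddFarBump (reflect n x) = - oddFarBump x := by
  simp only [oddFarBump, reflect_reflect]; ring

theorem oddFarBump_of_coord_nonneg {x : EuclideanSpace ℝ (Fin n)} (h : 0 ≤ x 0) :
    oddFarBump x = farBump x := by
  rw [oddFarBump, farBump_of_coord_lt (x := reflect n x) (by rw [reflect_coord]; linarith),
    sub_zero]

theorem oddFarBump_of_mem_smallHalfBall {x : EuclideanSpace ℝ (Fin n)}
    (h : x ∈ smallHalfBall n) : oddFarBump x = 0 := by
  have hx0 : 0 < x 0 := h.2
  have h1 : ‖x‖ < 1 / 8 := mem_ball_zero_iff.1 h.1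
  rw [oddFarBump_of_coord_nonneg hx0.le]
  exact farBump_of_coord_lt (by linarith [(abs_le.1 (abs_coord_le_norm x)).2])

theorem continuous_oddFarBump : Continuous (oddFarBump : EuclideanSpace ℝ (Fin n) → ℝ) :=
  continuous_farBump.sub (continuous_farBump.comp (reflect n).continuous)

theorem memHs_oddFarBump {s : ℝ} (hs0 : 0 < s) (hs1 : s < 1) :
    MemHs s (oddFarBump : EuclideanSpace ℝ (Fin n) → ℝ) := by
  refine memHs_of_lipschitz (S := Metric.ball 0 1) (C := 1) hs0 hs1
    continuous_oddFarBump.aestronglyMeasurable measurableSet_ball measure_ball_lt_top ?_ ?_ ?_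
  · have h0 : ∀ x : EuclideanSpace ℝ (Fin n), 1 ≤ ‖x‖ → farBump x = 0 := by
      intro x hx
      by_contra hc
      linarith [(coord_bounds (norm_sub_lt_of_farBump_ne_zero hc).le).2.2]
    intro x hx
    rw [mem_ball_zero_iff, not_lt] at hx
    rw [oddFarBump, h0 x hx, h0 _ (by rwa [(reflect n).norm_map]), sub_zero]
  · intro x
    have h1 : ∀ y : EuclideanSpace ℝ (Fin n), farBump y ≤ 1 / 64 := fun y => bump_le _
    rw [oddFarBump, abs_le]
    constructor <;> linarith [h1 x, h1 (reflect n x), farBump_nonneg x,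
      farBump_nonneg (reflect n x)]
  · have h1 : ∀ x y : EuclideanSpace ℝ (Fin n), |farBump x - farBump y| ≤ 1 / 4 * ‖x - y‖ := by
      intro x y
      simpa [farBump] using abs_bump_sub_bump_le (x - (1 / 2 : ℝ) • e₁ n) (y - (1 / 2 : ℝ) • e₁ n)
    intro x _ y
    have h2 := h1 x y
    have h3 := h1 (reflect n x) (reflect n y)
    rw [← map_sub, (reflect n).norm_map] at h3
    have h4 : oddFarBump x - oddFarBump y =
        (farBump x - farBump y) - (farBump (reflect n x) - farBump (reflect n y)) := by
      simp only [oddFarBump]; ring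
    rw [h4]
    refine (abs_sub _ _).trans ?_
    linarith [norm_nonneg (x - y)]

theorem integrable_farBump : Integrable (farBump : EuclideanSpace ℝ (Fin n) → ℝ) := by
  refine continuous_farBump.integrable_of_hasCompactSupport ?_
  refine HasCompactSupport.of_support_subset_isCompact
    (isCompact_closedBall ((1 / 2 : ℝ) • e₁ n) (1 / 8)) fun x hx => ?_
  rw [Metric.mem_closedBall, dist_eq_norm]
  exact (norm_sub_lt_of_farBump_ne_zero hx).le

theorem integral_farBump_pos : 0 < ∫ x : EuclideanSpace ℝ (Fin n), farBump x := by
  rw [integral_pos_iff_support_of_nonneg farBump_nonneg integrable_farBump]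
  refine continuous_farBump.isOpen_support.measure_pos volume ⟨(1 / 2 : ℝ) • e₁ n, ?_⟩
  simp [farBump, bump]

/-- Since `v` and `oddFarBump` have disjoint supports up to a null set, only the cross terms
survive, and the form becomes -2∬ v(x) g(y) K(x, y). Folding y with its reflection replaces K by a
kernel difference, which `le_kern_sub_reflect` bounds below by a multiple of x₁. -/
theorem integral_energyDensity_oddFarBump_le {s : ℝ} (hs0 : 0 < s) (hs1 : s < 1)
    {v : EuclideanSpace ℝ (Fin n) → ℝ} (hv : MemHs s v)
    (hv0 : ∀ᵐ x, x ∉ smallHalfBall n → v x = 0) (hvn : ∀ x, 0 ≤ v x) :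
    ∫ p, energyDensity s oddFarBump v p ≤
      -(s * (5 ^ (((n : ℝ) + 2 * s) / 2))⁻¹ / 5 * (∫ y : EuclideanSpace ℝ (Fin n), farBump y)) *
        ∫ x, x 0 * v x := by
  set c₀ : ℝ := s * (5 ^ (((n : ℝ) + 2 * s) / 2))⁻¹ / 5 with hc₀
  have hint := (memHs_oddFarBump (n := n) hs0 hs1).integrable_energyDensity hv
  set G : EuclideanSpace ℝ (Fin n) × EuclideanSpace ℝ (Fin n) → ℝ :=
    fun p => v p.1 * oddFarBump p.2 * kern s p.1 p.2 with hG
  have hv1 : ∀ᵐ p : EuclideanSpace ℝ (Fin n) × EuclideanSpace ℝ (Fin n),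
      p.1 ∉ smallHalfBall n → v p.1 = 0 :=
    Measure.quasiMeasurePreserving_fst.ae hv0
  have hv2 : ∀ᵐ p : EuclideanSpace ℝ (Fin n) × EuclideanSpace ℝ (Fin n),
      p.2 ∉ smallHalfBall n → v p.2 = 0 :=
    Measure.quasiMeasurePreserving_snd.ae hv0
  have hvg : ∀ x : EuclideanSpace ℝ (Fin n), (x ∉ smallHalfBall n → v x = 0) →
      v x * oddFarBump x = 0 := by
    intro x hx
    by_cases h : x ∈ smallHalfBall n
    · rw [oddFarBump_of_mem_smallHalfBall h, mul_zero]
    · rw [hx h, zero_mul]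
  -- For x in the small half-ball `G` is minus the energy density a.e., so integrability is
  -- inherited.
  have hGint : Integrable G := by
    have h1 : Integrable ((Prod.fst ⁻¹' smallHalfBall n).indicator
        (fun p => -energyDensity s oddFarBump v p)) :=
      hint.neg.indicator (measurable_fst measurableSet_smallHalfBall)
    refine h1.congr ?_
    filter_upwards [hv1, hv2] with p h1 h2
    by_cases h : p.1 ∈ smallHalfBall n
    · rw [Set.indicator_of_mem (by exact h)]
      simp only [hG, energyDensity, oddFarBump_of_mem_smallHalfBall h]
      linear_combination (-kern s p.1 p.2) * hvg p.2 h2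
    · rw [Set.indicator_of_notMem (by exact h)]
      simp [hG, h1 h]
  have hEG : ∫ p, energyDensity s oddFarBump v p = -(2 * ∫ p, G p) := by
    have h1 : ∫ p : EuclideanSpace ℝ (Fin n) × EuclideanSpace ℝ (Fin n), G p.swap = ∫ p, G p :=
      integral_prod_swap G
    have h2 : Integrable fun p : EuclideanSpace ℝ (Fin n) × EuclideanSpace ℝ (Fin n) =>
      G p.swap := hGint.swap
    rw [two_mul]
    nth_rewrite 2 [← h1]
    rw [← integral_add hGint h2, ← integral_neg]
    refine integral_congr_ae ?_
    filter_upwards [hv1, hv2] with p h1 h2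
    simp only [hG, energyDensity, Prod.fst_swap, Prod.snd_swap, kern_symm s p.2 p.1]
    linear_combination (kern s p.1 p.2) * hvg p.2 h2 + (kern s p.1 p.2) * hvg p.1 h1
  have hGR : Integrable fun p : EuclideanSpace ℝ (Fin n) × EuclideanSpace ℝ (Fin n) =>
      G (p.1, reflect n p.2) :=
    (measurePreserving_reflect_snd.integrable_comp hGint.1).2 hGint
  have hGRe : ∫ p : EuclideanSpace ℝ (Fin n) × EuclideanSpace ℝ (Fin n),
      G (p.1, reflect n p.2) = ∫ p, G p :=
    measurePreserving_reflect_snd.integral_comp measurableEmbedding_reflect_snd G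
  have hlow : ∫ p : EuclideanSpace ℝ (Fin n) × EuclideanSpace ℝ (Fin n),
      (p.1 0 * v p.1) * (c₀ * farBump p.2) ≤ ∫ p, (G p + G (p.1, reflect n p.2)) := by
    refine integral_mono_ae ((integrable_coord_mul hv.1 hv0).mul_prod
      (integrable_farBump.const_mul c₀)) (hGint.add hGR) ?_
    filter_upwards [hv1] with p h1
    obtain ⟨x, y⟩ := p
    by_cases h : x ∈ smallHalfBall n
    swap
    · have : v x = 0 := h1 h
      simp [hG, this]
    have hx0 : 0 < x 0 := h.2
    have hxn : ‖x‖ < 1 / 8 := mem_ball_zero_iff.1 h.1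
    have hx1 : x 0 ≤ 1 / 8 := by linarith [(abs_le.1 (abs_coord_le_norm x)).2]
    have hmain : (x 0 * c₀) * farBump y ≤
        oddFarBump y * (kern s x y - kern s x (reflect n y)) := by
      -- If only the mirror bump is nonzero at `y`, both factors on the right are nonpositive; this
      -- contribution is simply dropped.
      by_cases hy : farBump y = 0
      · rw [hy, mul_zero, oddFarBump, hy]
        by_cases hy' : farBump (reflect n y) = 0
        · simp [hy']
        · have hb := coord_bounds (norm_sub_lt_of_farBump_ne_zero hy').le
          have hne : x ≠ reflect n y := by
            intro h
            rw [h] at hx1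
            linarith [hb.1]
          rw [reflect_coord] at hb
          have := kern_le_reflect hs0 hne (mul_nonpos_of_nonneg_of_nonpos hx0.le (by linarith [hb.1]))
          nlinarith [farBump_nonneg (reflect n y)]
      · have hb := coord_bounds (norm_sub_lt_of_farBump_ne_zero hy).le
        rw [oddFarBump_of_coord_nonneg (by linarith [hb.1])]
        have hne : x ≠ y := by
          intro h
          rw [h] at hx1
          linarith [hb.1]
        have h2 := le_kern_sub_reflect hs0 hne ((norm_sub_le x y).trans (by linarith [hb.2.2]))
          hx0.le (by linarith) (by linarith [hb.1]) (by linarith [hb.2.1])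
        rw [← hc₀] at h2
        nlinarith [mul_le_mul_of_nonneg_left h2 (farBump_nonneg y)]
    have := mul_le_mul_of_nonneg_left hmain (hvn x)
    simp only [hG, oddFarBump_reflect]
    linarith
  rw [integral_add hGint hGR, hGRe] at hlow
  have hprod := integral_prod_mul (μ := (volume : Measure (EuclideanSpace ℝ (Fin n))))
    (ν := (volume : Measure (EuclideanSpace ℝ (Fin n)))) (fun x => x 0 * v x)
    (fun y => c₀ * farBump y)
  rw [← Measure.volume_eq_prod] at hprod
  rw [hprod, integral_const_mul] at hlow
  rw [hEG]
  linarith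

end

section

/-! ### Comparison with the barrier -/

theorem exists_ae_abs_le {X : Type*} [MeasurableSpace X] {c : X → ℝ}
    {μ : Measure X} (hc : MemLp c ∞ μ) :
    ∃ C : ℝ, 0 ≤ C ∧ ∀ᵐ x ∂μ, |c x| ≤ C := by
  refine ⟨(eLpNormEssSup c μ).toReal, ENNReal.toReal_nonneg, ?_⟩
  have hfin : eLpNormEssSup c μ ≠ ∞ := by
    rw [← eLpNorm_exponent_top]; exact hc.2.ne
  filter_upwards [ae_le_eLpNormEssSup (f := c) (μ := μ)] with x hx
  rw [← Real.norm_eq_abs, ← toReal_enorm]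
  exact (ENNReal.toReal_le_toReal enorm_ne_top hfin).2 hx

variable {n : ℕ} [NeZero n]

theorem isOpen_smallHalfBall : IsOpen (smallHalfBall n) :=
  Metric.isOpen_ball.inter
    (isOpen_lt continuous_const (by fun_prop : Continuous fun x : EuclideanSpace ℝ (Fin n) => x 0))

theorem smallHalfBall_subset_halfBall : smallHalfBall n ⊆ halfBall n :=
  Set.inter_subset_inter_left _ (Metric.ball_subset_ball (by norm_num))

theorem exists_pos_le_of_farBump_ne_zero {u : EuclideanSpace ℝ (Fin n) → ℝ}
    (hcont : ContinuousOn u (Metric.ball 0 1)) (hpos : ∀ x ∈ halfBall n, 0 < u x) :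
    ∃ m : ℝ, 0 < m ∧ ∀ x, farBump x ≠ 0 → m ≤ u x := by
  have hsub : Metric.closedBall ((1 / 2 : ℝ) • e₁ n) (1 / 8) ⊆ halfBall n := by
    intro x hx
    rw [Metric.mem_closedBall, dist_eq_norm] at hx
    have hb := coord_bounds hx
    refine ⟨mem_ball_zero_iff.2 (by linarith [hb.2.2]), ?_⟩
    change 0 < x 0
    linarith [hb.1]
  obtain ⟨x₀, hx₀, hmin⟩ := (isCompact_closedBall ((1 / 2 : ℝ) • e₁ n) (1 / 8)).exists_isMinOn
    (Metric.nonempty_closedBall.2 (by norm_num))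
    (hcont.mono (hsub.trans Set.inter_subset_left))
  refine ⟨u x₀, hpos _ (hsub hx₀), fun x hx => hmin ?_⟩
  rw [Metric.mem_closedBall, dist_eq_norm]
  exact (norm_sub_lt_of_farBump_ne_zero hx).le

/-- The barrier `φ + M g`, where `φ = coordBump` and `g = oddFarBump`, has
`(-Δ)^s (φ + M g) + C (φ + M g) ≤ - x₁` weakly in the small half-ball when `M` is large. -/
theorem exists_barrier {s : ℝ} (hs0 : 0 < s) (hs1 : s < 1) {C : ℝ} (hC : 0 ≤ C) :
    ∃ M : ℝ, 0 ≤ M ∧ ∀ v : EuclideanSpace ℝ (Fin n) → ℝ, MemHs s v →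
      (∀ᵐ x, x ∉ smallHalfBall n → v x = 0) → (∀ x, 0 ≤ v x) →
      energy s (fun x => coordBump x + M * oddFarBump x) v + C / 64 * ∫ x, x 0 * v x ≤
        -∫ x, x 0 * v x := by
  have hF := fracConst_pos (n := n) hs0 hs1
  set F := fracConst n s / 2 with hFdef
  have hF0 : 0 < F := by rw [hFdef]; linarith
  set κ := ∫ z : EuclideanSpace ℝ (Fin n), min (‖z‖ ^ 2) 1 * (‖z‖ ^ ((n : ℝ) + 2 * s))⁻¹ with hκ
  have hκ0 : 0 ≤ κ := integral_nonneg fun z => by positivity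
  set b := s * (5 ^ (((n : ℝ) + 2 * s) / 2))⁻¹ / 5 *
    (∫ y : EuclideanSpace ℝ (Fin n), farBump y) with hb
  have hb0 : 0 < b := by
    have := integral_farBump_pos (n := n)
    positivity
  -- `M` is chosen so that the far bump absorbs the bound for `coordBump` and the zeroth-order term
  -- C/64, with 1 to spare.
  refine ⟨(F * (6 * κ) + C / 64 + 1) / (F * b), by positivity, fun v hv hv0 hvn => ?_⟩
  set M := (F * (6 * κ) + C / 64 + 1) / (F * b) with hM
  have hM0 : 0 ≤ M := by positivity
  have hMb : M * (F * b) = F * (6 * κ) + C / 64 + 1 := by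
    rw [hM]; field_simp
  rw [energy_add_const_mul (memHs_coordBump hs0 hs1) (memHs_oddFarBump hs0 hs1) hv, energy_eq,
    energy_eq, ← hFdef]
  have h1 := mul_le_mul_of_nonneg_left
    (integral_energyDensity_coordBump_le hs0 hs1 hv hv0 hvn) hF0.le
  have h2 := mul_le_mul_of_nonneg_left (mul_le_mul_of_nonneg_left
    (integral_energyDensity_oddFarBump_le hs0 hs1 hv hv0 hvn) hF0.le) hM0
  rw [← hκ] at h1
  rw [← hb] at h2
  have h3 : M * (F * (-b * ∫ x, x 0 * v x)) =
      -(F * (6 * κ) + C / 64 + 1) * ∫ x, x 0 * v x := by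
    rw [← hMb]; ring
  rw [h3] at h2
  linarith

/-- An antisymmetric supersolution which is positive in the half-ball lies above a positive
multiple of `coordBump` near the origin. -/
theorem exists_mul_coordBump_le {s : ℝ} (hs0 : 0 < s) (hs1 : s < 1)
    {c u : EuclideanSpace ℝ (Fin n) → ℝ}
    (hc : MemLp c ∞ (volume.restrict (halfBall n))) (hu : MemHs s u)
    (hcont : ContinuousOn u (Metric.ball 0 1)) (hanti : IsAntisymmetric u)
    (hsuper : IsWeakSupersolution s (halfBall n) c u)
    (hnonneg : ∀ᵐ x, x ∈ halfSpace n → 0 ≤ u x) (hpos : ∀ x ∈ halfBall n, 0 < u x) :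
    ∃ ε : ℝ, 0 < ε ∧ ∀ x ∈ smallHalfBall n, ε * coordBump x ≤ u x := by
  obtain ⟨C, hC, hcC⟩ := exists_ae_abs_le hc
  obtain ⟨m, hm, hmu⟩ := exists_pos_le_of_farBump_ne_zero hcont hpos
  obtain ⟨M, hM, hbar⟩ := exists_barrier (n := n) hs0 hs1 hC
  -- This gives εM ≤ m, so εΦ stays below `u` on the far bump; the added 1 covers M = 0.
  set ε := m / (M + 1) with hε
  have hε0 : 0 < ε := by positivity
  have hεM : ε * M ≤ m := by
    rw [hε, div_mul_eq_mul_div, div_le_iff₀ (by positivity)]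
    nlinarith
  set Φ : EuclideanSpace ℝ (Fin n) → ℝ := fun x => coordBump x + M * oddFarBump x with hΦ
  set w : EuclideanSpace ℝ (Fin n) → ℝ := fun x => u x + (-ε) * Φ x with hw
  have hΦH : MemHs s Φ := (memHs_coordBump hs0 hs1).add ((memHs_oddFarBump hs0 hs1).const_mul M)
  have hwH : MemHs s w := hu.add (hΦH.const_mul _)
  have hwA : IsAntisymmetric w := by
    intro x
    change w (reflect n x) = - w x
    simp only [hw, hΦ, hanti.reflect, coordBump_reflect, oddFarBump_reflect]
    ring
  set v := halfNegPart w with hv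
  have hvH : MemHs s v := memHs_halfNegPart hs0 hwA hwH
  have hvn : ∀ x, 0 ≤ v x := halfNegPart_nonneg
  have hv0 : ∀ᵐ x, x ∉ smallHalfBall n → v x = 0 := by
    filter_upwards [hnonneg] with x hx hxs
    rcases le_or_gt (x 0) 0 with h | h
    · exact halfNegPart_of_nonpos h
    have hxn : 1 / 8 ≤ ‖x‖ := by
      by_contra hlt
      exact hxs ⟨mem_ball_zero_iff.2 (not_le.1 hlt), h⟩
    rw [hv, halfNegPart_of_pos h]
    refine max_eq_right ?_
    simp only [hw, hΦ, coordBump, bump_of_le hxn, oddFarBump_of_coord_nonneg h.le]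
    by_cases hf : farBump x = 0
    · rw [hf]; linarith [hx h]
    · have h1 := hmu x hf
      have h2 : farBump x ≤ 1 / 64 := bump_le _
      have h3 : ε * M * farBump x ≤ ε * M * 1 :=
        mul_le_mul_of_nonneg_left (by linarith) (by positivity)
      linarith
  have hsmall : ∀ x ∈ smallHalfBall n, w x = u x - ε * coordBump x := by
    intro x hx
    simp only [hw, hΦ, oddFarBump_of_mem_smallHalfBall hx]
    ring
  have hA0 : ∀ x : EuclideanSpace ℝ (Fin n), 0 ≤ x 0 * v x := by
    intro x
    rcases le_or_gt (x 0) 0 with h | h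
    · rw [hv, halfNegPart_of_nonpos h, mul_zero]
    · exact mul_nonneg h.le (hvn x)
  have hAint := integrable_coord_mul hvH.1 hv0
  set A := ∫ x, x 0 * v x with hA
  have huv : Integrable fun x => u x * v x := hu.1.integrable_mul hvH.1
  have huv0 : ∀ᵐ x, 0 ≤ u x * v x := by
    filter_upwards [hnonneg] with x hx
    rcases le_or_gt (x 0) 0 with h | h
    · rw [hv, halfNegPart_of_nonpos h, mul_zero]
    · exact mul_nonneg (hx h) (hvn x)
  -- Where `v` is positive, `w` is negative, hence u < ε · `coordBump` ≤ ε x₁/64.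
  have huvA : ∫ x, u x * v x ≤ ε / 64 * A := by
    rw [hA, ← integral_const_mul]
    refine integral_mono_ae huv (hAint.const_mul _) ?_
    filter_upwards [hv0] with x hx
    by_cases h : x ∈ smallHalfBall n
    · have hx0 : 0 < x 0 := h.2
      have h1 := mul_halfNegPart_nonpos (w := w) x
      rw [← hv, hsmall x h] at h1
      have h2 : coordBump x ≤ x 0 * (1 / 64) := mul_le_mul_of_nonneg_left (bump_le x) hx0.le
      have h3 := mul_le_mul_of_nonneg_right (mul_le_mul_of_nonneg_left h2 hε0.le) (hvn x)
      linarith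
    · simp [hx h]
  have hcuv : ∫ x in halfBall n, c x * u x * v x ≤ C * ∫ x, u x * v x := by
    have h1 : ‖∫ x in halfBall n, c x * u x * v x‖ ≤ ∫ x in halfBall n, C * (u x * v x) := by
      refine norm_integral_le_of_norm_le (huv.const_mul C).integrableOn ?_
      filter_upwards [hcC, ae_restrict_of_ae huv0] with x h1 h2
      rw [mul_assoc, norm_mul, Real.norm_of_nonneg h2, Real.norm_eq_abs]
      exact mul_le_mul_of_nonneg_right h1 h2
    have h2 : ∫ x in halfBall n, C * (u x * v x) ≤ ∫ x, C * (u x * v x) := by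
      refine setIntegral_le_integral (huv.const_mul C) ?_
      filter_upwards [huv0] with x hx
      exact mul_nonneg hC hx
    exact (le_abs_self _).trans (h1.trans (h2.trans_eq (integral_const_mul _ _)))
  have hsup := hsuper v ⟨hvH, by
    filter_upwards [hv0] with x hx h
    exact hx fun h' => h (smallHalfBall_subset_halfBall h')⟩ (Eventually.of_forall hvn)
  have hEw := energy_halfNegPart_nonpos hs0 hs1 hwA hwH
  rw [← hv, hw, energy_add_const_mul hu hΦH hvH] at hEw
  have hEΦ := mul_le_mul_of_nonneg_left (hbar v hvH hv0 hvn) hε0.le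
  rw [← hA] at hEΦ
  have hCuv := mul_le_mul_of_nonneg_left huvA hC
  -- The chain is 0 ≤ 𝓔(u,v) + ∫cuv ≤ ε𝓔(Φ,v) + εCA/64 ≤ -εA.
  have hAle : A ≤ 0 := by
    by_contra hlt
    nlinarith [mul_pos hε0 (not_le.1 hlt)]
  have hAz : (fun x : EuclideanSpace ℝ (Fin n) => x 0 * v x) =ᵐ[volume] 0 :=
    (integral_eq_zero_iff_of_nonneg hA0 hAint).1 (le_antisymm hAle (integral_nonneg hA0))
  refine ⟨ε, hε0, fun x hx => ?_⟩
  by_contra hlt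
  rw [not_le] at hlt
  -- A violation at one point would persist on a nonempty open set, which has positive measure,
  -- while x₁v vanishes a.e.
  have hcs : ContinuousOn (fun x => ε * coordBump x - u x) (smallHalfBall n) :=
    (continuous_const.mul continuous_coordBump).continuousOn.sub
      (hcont.mono (smallHalfBall_subset_halfBall.trans Set.inter_subset_left))
  have hopen := hcs.isOpen_inter_preimage isOpen_smallHalfBall (isOpen_Ioi (a := (0 : ℝ)))
  have hmeas := hopen.measure_pos volume ⟨x, hx, by
    simp only [Set.mem_preimage, Set.mem_Ioi]; linarith⟩
  refine hmeas.ne' (measure_mono_null ?_ hAz)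
  rintro y ⟨hy, hy'⟩ hy0
  have hyp : 0 < y 0 := hy.2
  have hy0' : y 0 * v y = 0 := hy0
  simp only [Set.mem_preimage, Set.mem_Ioi] at hy'
  rw [hv, halfNegPart_of_pos hyp, hsmall y hy] at hy0'
  have : 0 < max (-(u y - ε * coordBump y)) 0 := lt_max_of_lt_left (by linarith)
  exact (mul_pos hyp this).ne' hy0'

end

end FracHopf

end

/-! ### From the barrier bound to the difference quotient at the origin. -/

theorem theorem1p1 (n : ℕ) [NeZero n] (s : ℝ) (hs0 : 0 < s) (hs1 : s < 1)
    (c u : EuclideanSpace ℝ (Fin n) → ℝ)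
    (hc : MemLp c ∞ (volume.restrict (FracHopf.halfBall n)))
    (hu : FracHopf.MemHs s u)
    (hcont : ContinuousOn u (Metric.ball 0 1))
    (hanti : FracHopf.IsAntisymmetric u)
    (hsuper : FracHopf.IsWeakSupersolution s (FracHopf.halfBall n) c u)
    (hnonneg : ∀ᵐ x, x ∈ FracHopf.halfSpace n → 0 ≤ u x)
    (hpos : ∀ x ∈ FracHopf.halfBall n, 0 < u x) :
    0 < liminf (fun h : ℝ => ((u (h • FracHopf.e₁ n) / h : ℝ) : EReal)) (𝓝[≠] (0 : ℝ)) := by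
  obtain ⟨ε, hε, hle⟩ := FracHopf.exists_mul_coordBump_le hs0 hs1 hc hu hcont hanti hsuper
    hnonneg hpos
  -- For h < 1/16, 1/64 - h² ≥ 1/64 - 1/256 = 3/256.
  have hpt : ∀ h : ℝ, 0 < h → h < 1 / 16 → ε * (3 / 256) ≤ u (h • FracHopf.e₁ n) / h := by
    intro h h0 h1
    have hnorm : ‖h • FracHopf.e₁ n‖ = h := by
      rw [norm_smul, FracHopf.norm_e₁, mul_one, Real.norm_of_nonneg h0.le]
    have hcoord : (h • FracHopf.e₁ n) 0 = h := by simp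
    have hmem : h • FracHopf.e₁ n ∈ FracHopf.smallHalfBall n := by
      refine ⟨mem_ball_zero_iff.2 (by linarith), ?_⟩
      change 0 < (h • FracHopf.e₁ n) 0
      rwa [hcoord]
    have h2 := hle _ hmem
    rw [FracHopf.coordBump, FracHopf.bump_of_lt (by linarith), hcoord, hnorm] at h2
    rw [le_div_iff₀ h0]
    refine le_trans ?_ h2
    rw [mul_assoc]
    refine mul_le_mul_of_nonneg_left ?_ hε.le
    nlinarith [mul_pos h0 h0]
  -- The quotient is even in h, so negative h reduces to positive h.
  have hodd : ∀ h : ℝ, u (h • FracHopf.e₁ n) / h = u ((-h) • FracHopf.e₁ n) / (-h) := by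
    intro h
    have h1 := hanti (h • FracHopf.e₁ n)
    have h2 : h • FracHopf.e₁ n - (2 * (h • FracHopf.e₁ n) 0) • FracHopf.e₁ n
        = (-h) • FracHopf.e₁ n := by
      rw [PiLp.smul_apply, FracHopf.e₁_zero, smul_eq_mul]; module
    rw [h2] at h1
    rw [h1, neg_div_neg_eq]
  have hev : ∀ᶠ h : ℝ in 𝓝[≠] (0 : ℝ),
      ((ε * (3 / 256) : ℝ) : EReal) ≤ ((u (h • FracHopf.e₁ n) / h : ℝ) : EReal) := by
    have hnear : ∀ᶠ h : ℝ in 𝓝[≠] (0 : ℝ), |h| < 1 / 16 :=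
      nhdsWithin_le_nhds (continuous_abs.continuousAt.eventually_lt_const (by norm_num))
    filter_upwards [hnear, self_mem_nhdsWithin] with h h1 h2
    rw [EReal.coe_le_coe_iff]
    rw [abs_lt] at h1
    rcases lt_or_gt_of_ne (show h ≠ 0 from h2) with h3 | h3
    · rw [hodd]
      exact hpt _ (by linarith) (by linarith)
    · exact hpt h h3 h1.2
  refine lt_of_lt_of_le ?_ (le_liminf_of_le (by isBoundedDefault) hev)
  exact_mod_cast (by positivity : (0 : ℝ) < ε * (3 / 256))
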